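/- All vector spaces are real. Let $X$ be a non-empty locally compact Hausdorff space with Borel $\sigma$-algebra $\mathscr B$, and let $E$ be a Dedekind complete vector lattice that is normal, i.e. the order bounded, order continuous linear functionals on $E$ separate the points of $E$. An $E^+$-valued measure is a map $\nu\colon\mathscr B\to E^+$ with $\nu(\emptyset)=0$ and $\nu(\bigcup_n\Delta_n)=\sup_N\sum_{n=1}^N\nu(\Delta_n)$ for every pairwise disjoint sequence $(\Delta_n)$ in $\mathscr B$. It is a regular Borel measure if $\nu(U)=\sup\{\nu(K): K\subseteq U \text{ compact}\}$ for all open $U$ and $\nu(\Delta)=\inf\{\nu(V): V\supseteq\Delta\text{ open}\}$ for all $\Delta\in\mathscr B$. Let $M_{rB}(X,\mathscr B,E)$ be the linear span of the $E^+$-valued regular Borel measures in the space of all maps $\mathscr B\to E$, with the pointwise ordering. For an $E^+$-valued measure $\nu$ and a bounded Borel function $g\ge 0$, the order integral $\int g\,d\nu\in E$ is $\sup_n\int\varphi_n\,d\nu$, where $(\varphi_n)$ is a sequence of simple functions with $0\le\varphi_n\uparrow g$ pointwise and $\int\sum_i r_i\chi_{\Delta_i}\,d\nu=\sum_i r_i\nu(\Delta_i)$.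 For $\mu\in M_{rB}(X,\mathscr B,E)$ and a bounded Borel function $f\colon X\to\mathbb R$, put $I_\mu(f)=(\int f^+d\nu_1-\int f^-d\nu_1)-(\int f^+d\nu_2-\int f^-d\nu_2)$, where $\mu=\nu_1-\nu_2$ with $E^+$-valued measures $\nu_1,\nu_2$; this exists and does not depend on the choices made. Let $F$ be $C_c(X)$ or $C_0(X)$ (real-valued functions) with the uniform norm and the pointwise ordering. Let $L_{nob}(F,E)$ be the space of linear operators $F\to E$ that map norm bounded sets to order bounded sets, ordered by $S\le T$ iff $Sf\le Tf$ for all $f\ge 0$. Let $L_r(C(X),E)$ be the space of differences of two positive operators from $C(X)$ to $E$. Then $M_{rB}(X,\mathscr B,E)$, $L_{nob}(C_c(X),E)$ and $L_{nob}(C_0(X),E)$ are vector lattices, and the maps $\mu\mapsto I_\mu$ (1) from $M_{rB}(X,\mathscr B,E)$ to $L_{nob}(C_c(X),E)$, and (2) from $M_{rB}(X,\mathscr B,E)$ to $L_{nob}(C_0(X),E)$ are (well-defined) surjective vector lattice isomorphisms, i.e. linear bijections that preserve suprema and infima of pairs. When $X$ is compact (so that $C_c(X)=C_0(X)=C(X)$),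 the spaces $L_{nob}(C_c(X),E)$ and $L_{nob}(C_0(X),E)$ both coincide with $L_r(C(X),E)$. -/

import Mathlib

open scoped CompactlySupported ZeroAtInfty NNReal

/-! ## `C_c(X)` and `C₀(X)` as normed vector lattices

`C_c(X, ℝ)` carries its pointwise lattice structure in the library, and `C₀(X, ℝ)` its uniform norm.
The pointwise order on `C₀(X, ℝ)` and the uniform norm on `C_c(X, ℝ)` are added here. -/

section FunctionSpaces

variable {X : Type*} [TopologicalSpace X]

namespace ZeroAtInftyContinuousMap

instance instMaxReal : Max C₀(X, ℝ) where
  max f g :=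
    { toFun := fun x => max (f x) (g x)
      continuous_toFun := f.continuous.max g.continuous
      zero_at_infty' := by
        simpa using (zero_at_infty f).max (zero_at_infty g) }

instance instMinReal : Min C₀(X, ℝ) where
  min f g :=
    { toFun := fun x => min (f x) (g x)
      continuous_toFun := f.continuous.min g.continuous
      zero_at_infty' := by
        simpa using (zero_at_infty f).min (zero_at_infty g) }

/-- The pointwise partial order on `C₀(X, ℝ)`. -/
instance instPartialOrderReal : PartialOrder C₀(X, ℝ) :=
  PartialOrder.lift (fun f => (f : X → ℝ)) DFunLike.coe_injective

/-- The pointwise lattice structure on `C₀(X, ℝ)`. -/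
instance instLatticeReal : Lattice C₀(X, ℝ) where
  sup := max
  le_sup_left f g x := le_max_left (f x) (g x)
  le_sup_right f g x := le_max_right (f x) (g x)
  sup_le _ _ _ hf hg x := max_le (hf x) (hg x)
  inf := min
  inf_le_left f g x := min_le_left (f x) (g x)
  inf_le_right f g x := min_le_right (f x) (g x)
  le_inf _ _ _ hf hg x := le_min (hf x) (hg x)

instance instIsOrderedAddMonoidReal : IsOrderedAddMonoid C₀(X, ℝ) where
  add_le_add_left _ _ h k x := add_le_add_left (h x) (k x)

end ZeroAtInftyContinuousMap

namespace CompactlySupportedContinuousMap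

/-- The inclusion of `C_c(X, ℝ)` into `C₀(X, ℝ)`. -/
def toZeroAtInftyReal : C_c(X, ℝ) →ₗ[ℝ] C₀(X, ℝ) where
  toFun f := ⟨f.toContinuousMap, zero_at_infty f⟩
  map_add' _ _ := rfl
  map_smul' _ _ := rfl

theorem toZeroAtInftyReal_injective :
    Function.Injective (toZeroAtInftyReal : C_c(X, ℝ) →ₗ[ℝ] C₀(X, ℝ)) := by
  intro f g h
  ext x
  exact DFunLike.congr_fun h x

/-- The uniform norm on `C_c(X, ℝ)`. -/
noncomputable instance instNormedAddCommGroupReal : NormedAddCommGroup C_c(X, ℝ) :=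
  NormedAddCommGroup.induced C_c(X, ℝ) C₀(X, ℝ) toZeroAtInftyReal toZeroAtInftyReal_injective

end CompactlySupportedContinuousMap

/-- For compact `X`, the canonical identification of `C(X, ℝ)` with `C_c(X, ℝ)`. -/
def continuousLinearEquivCc (X : Type*) [TopologicalSpace X] [CompactSpace X] :
    C(X, ℝ) ≃ₗ[ℝ] C_c(X, ℝ) where
  __ := CompactlySupportedContinuousMap.continuousMapEquiv (α := X) (β := ℝ)
  map_add' _ _ := rfl
  map_smul' _ _ := rfl

/-- For compact `X`, the canonical identification of `C(X, ℝ)` with `C₀(X, ℝ)`. -/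
def continuousLinearEquivC₀ (X : Type*) [TopologicalSpace X] [CompactSpace X] :
    C(X, ℝ) ≃ₗ[ℝ] C₀(X, ℝ) where
  __ := ZeroAtInftyContinuousMap.ContinuousMap.liftZeroAtInfty (α := X) (β := ℝ)
  map_add' _ _ := rfl
  map_smul' _ _ := rfl

end FunctionSpaces

/-! ## Vector lattices -/

/-- Every non-empty subset that is bounded from above has a supremum. -/
def IsDedekindComplete (E : Type*) [Preorder E] : Prop :=
  ∀ S : Set E, S.Nonempty → BddAbove S → ∃ s, IsLUB S s

section OrderContinuity

variable {E F : Type*} [AddCommGroup E] [Lattice E] [AddCommGroup F] [Lattice F]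

/-- Order convergence of a net to `x`, expressed through its filter `l` of tails: there is a
non-empty downward directed set `D` with infimum `0` such that, for each `d ∈ D`, eventually
`|y - x| ≤ d`. -/
def OrderConverges (l : Filter E) (x : E) : Prop :=
  ∃ D : Set E, D.Nonempty ∧ DirectedOn (· ≥ ·) D ∧ IsGLB D 0 ∧
    ∀ d ∈ D, ∀ᶠ y in l, |y - x| ≤ d

variable [Module ℝ E] [Module ℝ F]

/-- An operator is order bounded when it maps order bounded sets to order bounded sets. -/
def IsOrderBoundedOp (T : E →ₗ[ℝ] F) : Prop :=
  ∀ S : Set E, BddAbove S → BddBelow S → BddAbove (T '' S) ∧ BddBelow (T '' S)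

/-- An operator is order continuous when it preserves order convergence (of nets). -/
def IsOrderContinuousOp (T : E →ₗ[ℝ] F) : Prop :=
  ∀ (l : Filter E) (x : E), OrderConverges l x → OrderConverges (l.map T) (T x)

end OrderContinuity

/-- A vector lattice is normal when its order bounded, order continuous functionals separate its
points. -/
def IsNormalVectorLattice (E : Type*) [AddCommGroup E] [Lattice E] [Module ℝ E] : Prop :=
  ∀ x : E, x ≠ 0 →
    ∃ φ : E →ₗ[ℝ] ℝ, IsOrderBoundedOp φ ∧ IsOrderContinuousOp φ ∧ φ x ≠ 0

/-- A partially ordered real vector space is a vector lattice. -/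
structure IsVectorLattice (V : Type*) [AddCommGroup V] [Module ℝ V] [PartialOrder V] : Prop where
  add_le_add : ∀ u v w : V, u ≤ v → u + w ≤ v + w
  smul_nonneg : ∀ (r : ℝ) (v : V), 0 ≤ r → 0 ≤ v → 0 ≤ r • v
  exists_sup : ∀ u v : V, ∃ s, IsLUB {u, v} s
  exists_inf : ∀ u v : V, ∃ s, IsGLB {u, v} s

/-- `Φ` is an isomorphism from the vector lattice `V` onto the vector lattice `W`: a linear bijection
that preserves suprema and infima of pairs. -/
structure IsVectorLatticeIso {V W : Type*} [AddCommGroup V] [Module ℝ V] [PartialOrder V]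
    [AddCommGroup W] [Module ℝ W] [PartialOrder W] (Φ : V →ₗ[ℝ] W) : Prop where
  isVectorLattice_domain : IsVectorLattice V
  isVectorLattice_codomain : IsVectorLattice W
  bijective : Function.Bijective Φ
  map_sup : ∀ u v s : V, IsLUB {u, v} s → IsLUB {Φ u, Φ v} (Φ s)
  map_inf : ∀ u v s : V, IsGLB {u, v} s → IsGLB {Φ u, Φ v} (Φ s)

/-! ## Spaces of operators -/

section Operators

variable (F E : Type*) [AddCommGroup E] [Lattice E] [IsOrderedAddMonoid E] [Module ℝ E]

/-- The regular operators from `F` to `E`: the differences of two positive operators. -/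
def regularOperators [AddCommGroup F] [PartialOrder F] [Module ℝ F] [IsOrderedModule ℝ E] :
    Submodule ℝ (F →ₗ[ℝ] E) where
  carrier := {T | ∃ P Q : F →ₗ[ℝ] E,
    (∀ f, 0 ≤ f → 0 ≤ P f) ∧ (∀ f, 0 ≤ f → 0 ≤ Q f) ∧ T = P - Q}
  zero_mem' := ⟨0, 0, by simp, by simp, by simp⟩
  add_mem' := by
    rintro _ _ ⟨P, Q, hP, hQ, rfl⟩ ⟨P', Q', hP', hQ', rfl⟩
    exact ⟨P + P', Q + Q', fun f hf => add_nonneg (hP f hf) (hP' f hf),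
      fun f hf => add_nonneg (hQ f hf) (hQ' f hf), by abel⟩
  smul_mem' := by
    rintro c _ ⟨P, Q, hP, hQ, rfl⟩
    rcases le_total 0 c with hc | hc
    · exact ⟨c • P, c • Q, fun f hf => smul_nonneg hc (hP f hf),
        fun f hf => smul_nonneg hc (hQ f hf), smul_sub c P Q⟩
    · exact ⟨(-c) • Q, (-c) • P, fun f hf => smul_nonneg (neg_nonneg.2 hc) (hQ f hf),
        fun f hf => smul_nonneg (neg_nonneg.2 hc) (hP f hf), by module⟩

variable [NormedAddCommGroup F] [Module ℝ F]

/-- The norm to order bounded operators from `F` to `E`: those that map norm bounded sets to order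
bounded sets. -/
def normToOrderBounded [IsOrderedModule ℝ E] : Submodule ℝ (F →ₗ[ℝ] E) where
  carrier := {T | ∀ S : Set F, Bornology.IsBounded S → BddAbove (T '' S) ∧ BddBelow (T '' S)}
  zero_mem' := fun S _ => ⟨⟨0, by rintro _ ⟨f, -, rfl⟩; simp⟩, ⟨0, by rintro _ ⟨f, -, rfl⟩; simp⟩⟩
  add_mem' := by
    intro T T' h h' S hS
    obtain ⟨⟨a, ha⟩, ⟨b, hb⟩⟩ := h S hS
    obtain ⟨⟨a', ha'⟩, ⟨b', hb'⟩⟩ := h' S hS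
    refine ⟨⟨a + a', ?_⟩, ⟨b + b', ?_⟩⟩
    · rintro _ ⟨f, hf, rfl⟩
      exact add_le_add (ha ⟨f, hf, rfl⟩) (ha' ⟨f, hf, rfl⟩)
    · rintro _ ⟨f, hf, rfl⟩
      exact add_le_add (hb ⟨f, hf, rfl⟩) (hb' ⟨f, hf, rfl⟩)
  smul_mem' := by
    intro c T h S hS
    obtain ⟨⟨a, ha⟩, ⟨b, hb⟩⟩ := h S hS
    rcases le_total 0 c with hc | hc
    · refine ⟨⟨c • a, ?_⟩, ⟨c • b, ?_⟩⟩
      · rintro _ ⟨f, hf, rfl⟩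
        exact smul_le_smul_of_nonneg_left (ha ⟨f, hf, rfl⟩) hc
      · rintro _ ⟨f, hf, rfl⟩
        exact smul_le_smul_of_nonneg_left (hb ⟨f, hf, rfl⟩) hc
    · refine ⟨⟨c • b, ?_⟩, ⟨c • a, ?_⟩⟩
      · rintro _ ⟨f, hf, rfl⟩
        exact smul_le_smul_of_nonpos_left (hb ⟨f, hf, rfl⟩) hc
      · rintro _ ⟨f, hf, rfl⟩
        exact smul_le_smul_of_nonpos_left (ha ⟨f, hf, rfl⟩) hc

/-- The operator order: `T ≤ T'` when `T f ≤ T' f` for all `f ≥ 0`. -/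
instance normToOrderBounded.instPartialOrder [IsOrderedModule ℝ E] [Lattice F]
    [IsOrderedAddMonoid F] : PartialOrder (normToOrderBounded F E) where
  le T T' := ∀ f : F, 0 ≤ f → T.1 f ≤ T'.1 f
  le_refl _ _ _ := le_rfl
  le_trans _ _ _ h h' f hf := (h f hf).trans (h' f hf)
  le_antisymm T T' h h' := by
    have key : ∀ f : F, 0 ≤ f → T.1 f = T'.1 f := fun f hf => le_antisymm (h f hf) (h' f hf)
    refine Subtype.ext (LinearMap.ext fun f => ?_)
    rw [← posPart_sub_negPart f, map_sub, map_sub, key _ (posPart_nonneg f),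
      key _ (negPart_nonneg f)]

end Operators

/-! ## Measures with values in a vector lattice, and the order integral -/

section Measures

variable {X E : Type*} [MeasurableSpace X] [AddCommGroup E] [Lattice E]

/-- A (finite) measure with values in the positive cone of `E`, as a set map on the `σ`-algebra. -/
structure IsPosMeasure (ν : {s : Set X // MeasurableSet s} → E) : Prop where
  nonneg : ∀ s, 0 ≤ ν s
  empty : ν ⟨∅, MeasurableSet.empty⟩ = 0
  sigma_additive : ∀ (Δ : ℕ → Set X) (hΔ : ∀ n, MeasurableSet (Δ n)),
    Pairwise (fun m n => Disjoint (Δ m) (Δ n)) →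
      IsLUB (Set.range fun N : ℕ => ∑ n ∈ Finset.range (N + 1), ν ⟨Δ n, hΔ n⟩)
        (ν ⟨⋃ n, Δ n, MeasurableSet.iUnion hΔ⟩)

/-- A regular Borel measure with values in the positive cone of `E`: inner regular at all open sets
and outer regular at all Borel sets. (It is finite, hence finite at compact sets.) -/
structure IsPosRegularBorelMeasure [TopologicalSpace X]
    (ν : {s : Set X // MeasurableSet s} → E) : Prop where
  isPosMeasure : IsPosMeasure ν
  innerRegular : ∀ U : {s : Set X // MeasurableSet s}, IsOpen U.1 →
    IsLUB {e | ∃ K : {s : Set X // MeasurableSet s}, IsCompact K.1 ∧ K.1 ⊆ U.1 ∧ ν K = e} (ν U)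
  outerRegular : ∀ Δ : {s : Set X // MeasurableSet s},
    IsGLB {e | ∃ V : {s : Set X // MeasurableSet s}, IsOpen V.1 ∧ Δ.1 ⊆ V.1 ∧ ν V = e} (ν Δ)

variable [Module ℝ E]

/-- The `E`-valued regular Borel measures on `X`: the linear span, in the space of set maps from the
`σ`-algebra to `E`, of those with values in the positive cone. It inherits the pointwise order. -/
def regularBorelMeasures (X E : Type*) [TopologicalSpace X] [MeasurableSpace X]
    [AddCommGroup E] [Lattice E] [Module ℝ E] :
    Submodule ℝ ({s : Set X // MeasurableSet s} → E) :=
  Submodule.span ℝ {ν | IsPosRegularBorelMeasure ν}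

/-- The order integral `∑ r • ν {φ = r}` of an elementary function `φ ≥ 0`. -/
noncomputable def elementaryIntegral (ν : {s : Set X // MeasurableSet s} → E)
    (φ : MeasureTheory.SimpleFunc X ℝ≥0) : E :=
  ∑ r ∈ φ.range, (r : ℝ) • ν ⟨φ ⁻¹' {r}, φ.measurableSet_fiber r⟩

/-- `e` is the order integral of `g ≥ 0` with respect to `ν ≥ 0`: the supremum of the integrals of
a sequence of elementary functions that increases pointwise to `g`. -/
def HasPosOrderIntegral (ν : {s : Set X // MeasurableSet s} → E) (g : X → ℝ≥0) (e : E) : Prop :=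
  ∃ φ : ℕ → MeasureTheory.SimpleFunc X ℝ≥0, Monotone φ ∧
    (∀ x, IsLUB (Set.range fun n => φ n x) (g x)) ∧
    IsLUB (Set.range fun n => elementaryIntegral ν (φ n)) e

/-- `e` is the order integral of the real function `f` with respect to the `E`-valued measure `μ`:
for a decomposition `μ = ν₁ - ν₂` into measures with values in the positive cone, `e` is
`(∫ f⁺ dν₁ - ∫ f⁻ dν₁) - (∫ f⁺ dν₂ - ∫ f⁻ dν₂)`. -/
def HasOrderIntegral (μ : {s : Set X // MeasurableSet s} → E) (f : X → ℝ) (e : E) : Prop :=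
  ∃ ν₁ ν₂ : {s : Set X // MeasurableSet s} → E,
    IsPosMeasure ν₁ ∧ IsPosMeasure ν₂ ∧ μ = ν₁ - ν₂ ∧
    ∃ p₁ n₁ p₂ n₂ : E,
      HasPosOrderIntegral ν₁ (fun x => (f x).toNNReal) p₁ ∧
      HasPosOrderIntegral ν₁ (fun x => (-f x).toNNReal) n₁ ∧
      HasPosOrderIntegral ν₂ (fun x => (f x).toNNReal) p₂ ∧
      HasPosOrderIntegral ν₂ (fun x => (-f x).toNNReal) n₂ ∧
      e = (p₁ - n₁) - (p₂ - n₂)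

open Classical in
/-- The order integral `I_μ(f)` (with value `0` if it does not exist). -/
noncomputable def orderIntegral (μ : {s : Set X // MeasurableSet s} → E) (f : X → ℝ) : E :=
  if h : ∃ e, HasOrderIntegral μ f e then h.choose else 0

end Measures

/-! The proof reduces everything to real measures by scalarization. A functional that separates
points is order bounded, so by Riesz–Kantorovich it has a positive part, and this part is again
order continuous. Hence the positive functionals that preserve directed suprema (`IsPosNormal`)
already separate the points of `E` (`IsNormalVectorLattice.eq_of_forall`). Equalities in `E` can
therefore be tested on such `φ`. With Dedekind completeness, so can the claim that a bound of a
directed set is its supremum or infimum (`isLUB_of_forall_isPosNormal`).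

For a positive `E`-valued measure `ν`, each `φ ∘ ν` is a finite real measure, and `ν` is a (regular)
measure as soon as it is nonnegative and all its scalarizations are (regular) measures. Since `φ
(I_μ f)` is a difference of Lebesgue integrals, the order integral is independent of choices and
bilinear. Uniqueness in the classical Riesz–Markov theorem makes `μ ↦ I_μ` injective on `C_c(X)`.

For surjectivity, Riesz–Kantorovich splits an operator into positive ones. For a positive `T`, let
`ω U` be the supremum of `T f` over `0 ≤ f ≤ 1` supported in `U`, and let `ν A` be the infimum of `ω
V` over open `V ⊇ A`. Both families are directed, so `φ` commutes with both steps and `φ ∘ ν` is the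
Riesz–Markov measure of `φ ∘ T`; norm to order boundedness makes it finite. Thus `ν` is regular and
represents `T` (`exists_isPosRegularBorelMeasure_orderIntegral_eq`).

As positive operators come from positive measures, the bijection preserves and reflects order, which
transports the lattice structure. The case of `C₀(X)` follows by restriction to the dense subspace
`C_c(X)`. For compact `X`, the constants dominate norm balls, so positive operators on `C(X)` are
norm to order bounded. -/

/-! ### Riesz–Kantorovich: positive parts of operators into a Dedekind complete space -/

section RieszKantorovich

variable {F E : Type*} [AddCommGroup F] [Lattice F] [IsOrderedAddMonoid F] [Module ℝ F]
  [IsOrderedModule ℝ F] [AddCommGroup E] [Module ℝ E]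

/-- An additive and positively homogeneous map on the positive cone extends linearly. -/
theorem exists_linearMap_eq_on_nonneg (S : F → E)
    (hadd : ∀ f g, 0 ≤ f → 0 ≤ g → S (f + g) = S f + S g)
    (hsmul : ∀ (c : ℝ) f, 0 ≤ c → 0 ≤ f → S (c • f) = c • S f) :
    ∃ L : F →ₗ[ℝ] E, ∀ f, 0 ≤ f → L f = S f := by
  -- The candidate extension `S f⁺ - S f⁻` does not depend on how `f` is written as a difference of
  -- positive elements.
  have key : ∀ f a b : F, 0 ≤ a → 0 ≤ b → f = a - b → S f⁺ - S f⁻ = S a - S b := by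
    intro f a b ha hb h
    have h1 : f⁺ + b = a + f⁻ := by
      have := posPart_sub_negPart f
      rw [h] at this ⊢
      rw [sub_eq_sub_iff_add_eq_add] at this
      exact this
    have h2 := congrArg S h1
    rw [hadd _ _ (posPart_nonneg f) hb, hadd _ _ ha (negPart_nonneg f)] at h2
    rwa [sub_eq_sub_iff_add_eq_add]
  refine ⟨{ toFun := fun f => S f⁺ - S f⁻, map_add' := ?_, map_smul' := ?_ }, ?_⟩
  · intro f g
    rw [key (f + g) (f⁺ + g⁺) (f⁻ + g⁻) (add_nonneg (posPart_nonneg f) (posPart_nonneg g))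
      (add_nonneg (negPart_nonneg f) (negPart_nonneg g))
      (by conv_lhs => rw [← posPart_sub_negPart f, ← posPart_sub_negPart g]
          abel),
      hadd _ _ (posPart_nonneg f) (posPart_nonneg g),
      hadd _ _ (negPart_nonneg f) (negPart_nonneg g)]
    abel
  · intro c f
    rcases le_total 0 c with hc | hc
    · rw [key (c • f) (c • f⁺) (c • f⁻) (smul_nonneg hc (posPart_nonneg f))
        (smul_nonneg hc (negPart_nonneg f))
        (by rw [← smul_sub, posPart_sub_negPart]),
        hsmul _ _ hc (posPart_nonneg f), hsmul _ _ hc (negPart_nonneg f), smul_sub, RingHom.id_apply]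
    · have hc' := neg_nonneg.2 hc
      rw [key (c • f) ((-c) • f⁻) ((-c) • f⁺) (smul_nonneg hc' (negPart_nonneg f))
        (smul_nonneg hc' (posPart_nonneg f))
        (by rw [← smul_sub, ← neg_sub f⁺, posPart_sub_negPart, neg_smul_neg]),
        hsmul _ _ hc' (posPart_nonneg f), hsmul _ _ hc' (negPart_nonneg f), RingHom.id_apply]
      module
  · intro f hf
    have h0 : S 0 = 0 := by simpa using hsmul 0 0 le_rfl le_rfl
    simp [posPart_of_nonneg hf, negPart_of_nonneg hf, h0]

variable [Lattice E] [IsOrderedAddMonoid E] [IsOrderedModule ℝ E]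

omit [IsOrderedAddMonoid E] in
theorem isLUB_smul_image {c : ℝ} (hc : 0 ≤ c) {A : Set E} (hA : A.Nonempty) {a : E}
    (h : IsLUB A a) : IsLUB ((fun x => c • x) '' A) (c • a) := by
  rcases hc.eq_or_lt with rfl | hc
  · simp [hA.image_const]
  · exact (OrderIso.smulRight (β := E) hc).isLUB_image'.2 h

/-- The positive part of an order bounded operator into a Dedekind complete vector lattice. -/
theorem exists_posPart_operator (hE : IsDedekindComplete E) (T : F →ₗ[ℝ] E)
    (hT : ∀ f, 0 ≤ f → BddAbove (T '' Set.Icc 0 f)) :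
    ∃ P : F →ₗ[ℝ] E, ∀ f, 0 ≤ f → IsLUB (T '' Set.Icc 0 f) (P f) := by
  have hne : ∀ f : F, 0 ≤ f → (T '' Set.Icc 0 f).Nonempty := fun f hf =>
    (Set.nonempty_Icc.2 hf).image _
  have hex : ∀ f : F, ∃ e, 0 ≤ f → IsLUB (T '' Set.Icc 0 f) e := fun f => by
    by_cases hf : 0 ≤ f
    · obtain ⟨e, he⟩ := hE _ (hne f hf) (hT f hf)
      exact ⟨e, fun _ => he⟩
    · exact ⟨0, fun h => absurd h hf⟩
  choose S hS using hex
  obtain ⟨L, hL⟩ := exists_linearMap_eq_on_nonneg S (fun f g hf hg => by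
    refine (hS _ (add_nonneg hf hg)).unique ?_
    convert (hS f hf).add (hS g hg) using 1
    ext e
    rw [Set.mem_add]
    constructor
    · rintro ⟨h, ⟨h0, hfg⟩, rfl⟩
      -- Riesz decomposition: an element of `[0, f + g]` splits into `h ⊓ f` in `[0, f]` and a
      -- remainder in `[0, g]`.
      refine ⟨_, ⟨h ⊓ f, ⟨le_inf h0 hf, inf_le_right⟩, rfl⟩, _, ⟨h - h ⊓ f,
        ⟨sub_nonneg.2 inf_le_left, ?_⟩, rfl⟩, by simp⟩
      rw [sub_le_comm]
      exact le_inf (sub_le_self _ hg) (sub_le_iff_le_add.2 hfg)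
    · rintro ⟨_, ⟨a, ha, rfl⟩, _, ⟨b, hb, rfl⟩, rfl⟩
      exact ⟨a + b, ⟨add_nonneg ha.1 hb.1, add_le_add ha.2 hb.2⟩, map_add T a b⟩)
    (fun c f hc hf => by
      refine (hS _ (smul_nonneg hc hf)).unique ?_
      convert isLUB_smul_image hc (hne f hf) (hS f hf) using 1
      rcases hc.eq_or_lt with rfl | hc
      · simp only [zero_smul, Set.Icc_self, Set.image_singleton, map_zero]
        rw [(hne f hf).image_const]
      · ext e
        constructor
        · rintro ⟨h, ⟨h0, hcf⟩, rfl⟩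
          refine ⟨_, ⟨c⁻¹ • h, ⟨smul_nonneg (inv_nonneg.2 hc.le) h0, ?_⟩, rfl⟩, ?_⟩
          · have := smul_le_smul_of_nonneg_left hcf (inv_nonneg.2 hc.le)
            rwa [inv_smul_smul₀ hc.ne'] at this
          · simp [smul_inv_smul₀ hc.ne']
        · rintro ⟨_, ⟨a, ha, rfl⟩, rfl⟩
          exact ⟨c • a, ⟨smul_nonneg hc.le ha.1, smul_le_smul_of_nonneg_left ha.2 hc.le⟩,
            map_smul T c a⟩)
  exact ⟨L, fun f hf => hL f hf ▸ hS f hf⟩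

end RieszKantorovich

theorem isDedekindComplete_real : IsDedekindComplete ℝ := fun _ hne hbdd =>
  ⟨_, isLUB_csSup hne hbdd⟩

/-! ### Positive normal functionals separate the points -/

section NormalFunctionals

variable {E : Type*} [AddCommGroup E] [Lattice E] [Module ℝ E]

/-- The functional converges to `0` along every net decreasing to `0`. -/
def VanishesAlongDecreasing (φ : E →ₗ[ℝ] ℝ) : Prop :=
  ∀ D : Set E, D.Nonempty → DirectedOn (· ≥ ·) D → IsGLB D 0 → ∀ ε > 0,
    ∃ d₀ ∈ D, ∀ d ∈ D, d ≤ d₀ → |φ d| < ε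

/-- A positive functional that preserves suprema of upward directed sets. -/
structure IsPosNormal (φ : E →ₗ[ℝ] ℝ) : Prop where
  nonneg : ∀ x, 0 ≤ x → 0 ≤ φ x
  map_isLUB : ∀ (D : Set E) (s : E), D.Nonempty → DirectedOn (· ≤ ·) D → IsLUB D s →
    IsLUB (φ '' D) (φ s)

theorem VanishesAlongDecreasing.sub {φ ψ : E →ₗ[ℝ] ℝ} (hφ : VanishesAlongDecreasing φ)
    (hψ : VanishesAlongDecreasing ψ) : VanishesAlongDecreasing (φ - ψ) := by
  intro D hne hD h0 ε hε
  obtain ⟨a, ha, ha'⟩ := hφ D hne hD h0 (ε / 2) (half_pos hε)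
  obtain ⟨b, hb, hb'⟩ := hψ D hne hD h0 (ε / 2) (half_pos hε)
  obtain ⟨c, hc, hca, hcb⟩ := hD a ha b hb
  refine ⟨c, hc, fun d hd hdc => ?_⟩
  have h1 := ha' d hd (hdc.trans hca)
  have h2 := hb' d hd (hdc.trans hcb)
  calc |φ d - ψ d| ≤ |φ d| + |ψ d| := abs_sub _ _
    _ < ε := by linarith

variable [IsOrderedAddMonoid E]

/-- The tail filter of `D`, viewed as a decreasing net, order converges to `0` with `D` itself as
the dominating set. In `ℝ`, a dominating set with infimum `0` contains elements below any `ε`. -/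
theorem IsOrderContinuousOp.vanishesAlongDecreasing {φ : E →ₗ[ℝ] ℝ}
    (hφ : IsOrderContinuousOp φ) : VanishesAlongDecreasing φ := by
  intro D hne hD h0 ε hε
  have hbasis : (⨅ d ∈ D, Filter.principal (D ∩ Set.Iic d)).HasBasis (fun d => d ∈ D)
      (fun d => D ∩ Set.Iic d) := by
    refine Filter.hasBasis_biInf_principal ?_ hne
    intro a ha b hb
    obtain ⟨c, hc, hca, hcb⟩ := hD a ha b hb
    exact ⟨c, hc, Set.inter_subset_inter_right _ (Set.Iic_subset_Iic.2 hca),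
      Set.inter_subset_inter_right _ (Set.Iic_subset_Iic.2 hcb)⟩
  obtain ⟨D', -, -, h0', hev⟩ := hφ (⨅ d ∈ D, Filter.principal (D ∩ Set.Iic d)) 0
    ⟨D, hne, hD, h0, fun d hd => hbasis.eventually_iff.2 ⟨d, hd, fun y hy => by
      rw [sub_zero, abs_of_nonneg (h0.1 hy.1)]
      exact hy.2⟩⟩
  obtain ⟨d', hd', hlt⟩ : ∃ d' ∈ D', d' < ε := by
    by_contra! hcon
    exact absurd (h0'.2 hcon) (not_le.2 hε)
  obtain ⟨d₀, hd₀, h⟩ := hbasis.eventually_iff.1 (Filter.eventually_map.1 (hev d' hd'))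
  refine ⟨d₀, hd₀, fun d hd hdd => ?_⟩
  have := h ⟨hd, hdd⟩
  simp only [map_zero, sub_zero] at this
  exact this.trans_lt hlt

/-- If `D` increases to `s`, then `s - D` decreases to `0`. -/
theorem VanishesAlongDecreasing.isPosNormal {φ : E →ₗ[ℝ] ℝ} (hφ : VanishesAlongDecreasing φ)
    (hpos : ∀ x, 0 ≤ x → 0 ≤ φ x) : IsPosNormal φ := by
  refine ⟨hpos, fun D s hne hD hs => ⟨?_, fun b hb => ?_⟩⟩
  · rintro _ ⟨d, hd, rfl⟩
    have := hpos _ (sub_nonneg.2 (hs.1 hd))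
    rw [map_sub] at this
    linarith
  · refine le_of_forall_pos_le_add fun ε hε => ?_
    obtain ⟨_, ⟨d, hd, rfl⟩, h⟩ := hφ ((fun d => s - d) '' D) (hne.image _) (by
      rintro _ ⟨a, ha, rfl⟩ _ ⟨b, hb, rfl⟩
      obtain ⟨c, hc, hca, hcb⟩ := hD a ha b hb
      exact ⟨_, ⟨c, hc, rfl⟩, sub_le_sub_left hca s, sub_le_sub_left hcb s⟩) ⟨by
        rintro _ ⟨d, hd, rfl⟩
        exact sub_nonneg.2 (hs.1 hd), fun x hx => by
        have : s ≤ s - x := hs.2 fun d hd => le_sub_comm.1 (hx ⟨d, hd, rfl⟩)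
        simpa using this⟩ ε hε
    have h1 := h _ ⟨d, hd, rfl⟩ le_rfl
    have h2 := hb ⟨d, hd, rfl⟩
    rw [map_sub] at h1
    linarith [(abs_lt.1 h1).2]

theorem IsPosNormal.mono {φ : E →ₗ[ℝ] ℝ} (hφ : IsPosNormal φ) : Monotone φ := fun x y h => by
  have := hφ.nonneg _ (sub_nonneg.2 h)
  rw [map_sub] at this
  linarith

theorem IsPosNormal.map_isGLB {φ : E →ₗ[ℝ] ℝ} (hφ : IsPosNormal φ) (D : Set E) (s : E)
    (hne : D.Nonempty) (hD : DirectedOn (· ≥ ·) D) (hs : IsGLB D s) : IsGLB (φ '' D) (φ s) := by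
  have := hφ.map_isLUB (-D) (-s) hne.neg (fun a ha b hb => by
    obtain ⟨c, hc, h1, h2⟩ := hD (-a) ha (-b) hb
    exact ⟨-c, by simpa using hc, le_neg.1 h1, le_neg.1 h2⟩) hs.neg
  rw [map_neg, ← Set.image_neg_eq_neg, Set.image_image] at this
  simp only [map_neg] at this
  rw [← Set.image_image (fun x => -x) φ, Set.image_neg_eq_neg, isLUB_neg] at this
  simpa using this

/-- The positive part of a functional that vanishes along decreasing nets does so as well. -/
theorem VanishesAlongDecreasing.posPart {φ φ' : E →ₗ[ℝ] ℝ} (hφ : VanishesAlongDecreasing φ)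
    (hP : ∀ x, 0 ≤ x → IsLUB (φ '' Set.Icc 0 x) (φ' x)) : VanishesAlongDecreasing φ' := by
  have hpos : ∀ x, 0 ≤ x → 0 ≤ φ' x := fun x hx =>
    (hP x hx).1 ⟨0, ⟨le_rfl, hx⟩, map_zero φ⟩
  have hmono : Monotone φ' := fun x y h => by
    have := hpos _ (sub_nonneg.2 h)
    rw [map_sub] at this
    linarith
  intro D hne hD h0 ε hε
  obtain ⟨b, hb⟩ := hne
  obtain ⟨_, ⟨y, hy, rfl⟩, hlt⟩ : ∃ r ∈ φ '' Set.Icc 0 b, φ' b - ε / 2 < r := by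
    by_contra! hcon
    have := (hP b (h0.1 hb)).2 hcon
    linarith
  -- With `y` nearly attaining the supremum that defines `φ' b`, the net `y ⊓ d` also decreases to
  -- `0`, so `φ` is small along it.
  obtain ⟨_, ⟨d, hd, rfl⟩, h⟩ := hφ ((fun d => y ⊓ d) '' D) (Set.Nonempty.image _ ⟨b, hb⟩) (by
    rintro _ ⟨a, ha, rfl⟩ _ ⟨b, hb, rfl⟩
    obtain ⟨c, hc, hca, hcb⟩ := hD a ha b hb
    exact ⟨_, ⟨c, hc, rfl⟩, inf_le_inf_left y hca, inf_le_inf_left y hcb⟩) ⟨by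
      rintro _ ⟨d, hd, rfl⟩
      exact le_inf hy.1 (h0.1 hd), fun x hx =>
      h0.2 fun d hd => (hx ⟨d, hd, rfl⟩).trans inf_le_right⟩ (ε / 2) (half_pos hε)
  obtain ⟨c, hc, hcd, hcb⟩ := hD d hd b hb
  refine ⟨c, hc, fun e he hec => ?_⟩
  rw [abs_of_nonneg (hpos e (h0.1 he))]
  -- Since `0 ≤ y - y ⊓ c ≤ b - c`, the value `φ (y - y ⊓ c)` is at most `φ' (b - c)`. Then `φ' c`
  -- is bounded by `φ' b - φ y`, below `ε / 2`, plus the small `φ (y ⊓ c)`.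
  have h1 : φ' c ≤ φ' b - (φ y - φ (y ⊓ c)) := by
    have h2 : φ (y - y ⊓ c) ≤ φ' (b - c) := by
      refine (hP _ (sub_nonneg.2 hcb)).1 ⟨_, ⟨sub_nonneg.2 inf_le_left, ?_⟩, rfl⟩
      rw [sub_le_iff_le_add, ← sub_le_iff_le_add']
      refine le_inf ?_ ?_
      · rw [sub_le_iff_le_add]
        exact le_add_of_nonneg_right (sub_nonneg.2 hcb)
      · rw [sub_le_iff_le_add, add_sub_cancel]
        exact hy.2
    rw [map_sub, map_sub] at h2
    linarith
  have h3 := (abs_lt.1 (h _ ⟨c, hc, rfl⟩ (inf_le_inf_left y hcd))).2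
  have h4 := hmono hec
  linarith

/-- On a normal vector lattice, the positive normal functionals separate the points. -/
theorem IsNormalVectorLattice.eq_of_forall [IsOrderedModule ℝ E] (hE' : IsNormalVectorLattice E) {x y : E}
    (h : ∀ φ : E →ₗ[ℝ] ℝ, IsPosNormal φ → φ x = φ y) : x = y := by
  by_contra hne
  obtain ⟨φ, hb, hc, hφ⟩ := hE' (x - y) (sub_ne_zero.2 hne)
  obtain ⟨P, hP⟩ := exists_posPart_operator isDedekindComplete_real φ
    fun f _ => (hb _ bddAbove_Icc bddBelow_Icc).1
  -- Both terms of `φ = P - (P - φ)` are positive normal, so they agree at `x` and `y`, and hence so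
  -- does `φ`.
  have hPn := hc.vanishesAlongDecreasing.posPart hP
  have h1 := h P (hPn.isPosNormal fun x hx => (hP x hx).1 ⟨0, ⟨le_rfl, hx⟩, map_zero φ⟩)
  have h2 := h (P - φ) ((hPn.sub hc.vanishesAlongDecreasing).isPosNormal fun x hx =>
    sub_nonneg.2 ((hP x hx).1 ⟨x, ⟨hx, le_rfl⟩, rfl⟩))
  simp only [LinearMap.sub_apply] at h2
  rw [map_sub] at hφ
  exact hφ (by linarith)

end NormalFunctionals

/-! ### Testing directed suprema and infima on functionals -/

section SeparatedSuprema

variable {E : Type*} [AddCommGroup E] [Lattice E] [IsOrderedAddMonoid E] [Module ℝ E]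
  [IsOrderedModule ℝ E]

/-- Dedekind completeness supplies a supremum `s`. Normal functionals preserve it, so they do not
distinguish `s` from `u`. -/
theorem isLUB_of_forall_isPosNormal (hE : IsDedekindComplete E) (hE' : IsNormalVectorLattice E)
    {D : Set E} {u : E} (hne : D.Nonempty) (hD : DirectedOn (· ≤ ·) D) (hu : u ∈ upperBounds D)
    (h : ∀ φ : E →ₗ[ℝ] ℝ, IsPosNormal φ → IsLUB (φ '' D) (φ u)) : IsLUB D u := by
  obtain ⟨s, hs⟩ := hE D hne ⟨u, hu⟩
  rwa [hE'.eq_of_forall fun φ hφ => (h φ hφ).unique (hφ.map_isLUB D s hne hD hs)]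

theorem isGLB_of_forall_isPosNormal (hE : IsDedekindComplete E) (hE' : IsNormalVectorLattice E)
    {D : Set E} {u : E} (hne : D.Nonempty) (hD : DirectedOn (· ≥ ·) D) (hu : u ∈ lowerBounds D)
    (h : ∀ φ : E →ₗ[ℝ] ℝ, IsPosNormal φ → IsGLB (φ '' D) (φ u)) : IsGLB D u := by
  suffices h : IsLUB (-D) (-u) by simpa using h.neg
  refine isLUB_of_forall_isPosNormal hE hE' hne.neg (fun a ha b hb => ?_) ?_ fun φ hφ => ?_
  · obtain ⟨c, hc, h1, h2⟩ := hD (-a) ha (-b) hb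
    exact ⟨-c, by simpa using hc, le_neg.1 h1, le_neg.1 h2⟩
  · intro a ha
    exact le_neg.1 (hu ha)
  · have := (h φ hφ).neg
    rw [map_neg, ← Set.image_neg_eq_neg, Set.image_image]
    rw [← Set.image_neg_eq_neg, Set.image_image] at this
    simpa only [map_neg] using this

end SeparatedSuprema

/-! ### Vector measures and their scalarizations -/

section Scalarization

open MeasureTheory

variable {X E : Type*} [MeasurableSpace X] [AddCommGroup E] [Module ℝ E]

/-- `m` is the finite measure `φ ∘ ν`. -/
structure IsScalarization (φ : E →ₗ[ℝ] ℝ) (ν : {s : Set X // MeasurableSet s} → E)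
    (m : Measure X) : Prop where
  isFiniteMeasure : IsFiniteMeasure m
  real_eq : ∀ s : {s : Set X // MeasurableSet s}, m.real s.1 = φ (ν s)

theorem IsScalarization.measure_eq {φ : E →ₗ[ℝ] ℝ} {ν : {s : Set X // MeasurableSet s} → E}
    {m : Measure X} (h : IsScalarization φ ν m) (s : {s : Set X // MeasurableSet s}) :
    m s.1 = ENNReal.ofReal (φ (ν s)) := by
  have := h.isFiniteMeasure
  rw [← h.real_eq, ofReal_measureReal]

theorem IsScalarization.eq {φ : E →ₗ[ℝ] ℝ} {ν : {s : Set X // MeasurableSet s} → E}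
    {m m' : Measure X} (h : IsScalarization φ ν m) (h' : IsScalarization φ ν m') : m = m' :=
  Measure.ext fun s hs => (h.measure_eq ⟨s, hs⟩).trans (h'.measure_eq ⟨s, hs⟩).symm

theorem IsScalarization.add {φ : E →ₗ[ℝ] ℝ} {ν ν' : {s : Set X // MeasurableSet s} → E}
    {m m' : Measure X} (h : IsScalarization φ ν m) (h' : IsScalarization φ ν' m') :
    IsScalarization φ (ν + ν') (m + m') := by
  have := h.isFiniteMeasure
  have := h'.isFiniteMeasure
  exact ⟨inferInstance, fun s => by
    rw [measureReal_add_apply, h.real_eq, h'.real_eq, Pi.add_apply, map_add]⟩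

theorem IsScalarization.smul {φ : E →ₗ[ℝ] ℝ} {ν : {s : Set X // MeasurableSet s} → E}
    {m : Measure X} (h : IsScalarization φ ν m) (c : ℝ≥0) :
    IsScalarization φ ((c : ℝ) • ν) (c • m) := by
  have := h.isFiniteMeasure
  exact ⟨inferInstance, fun s => by
    rw [measureReal_nnreal_smul_apply, h.real_eq, Pi.smul_apply, map_smul, smul_eq_mul]⟩

theorem isScalarization_zero (φ : E →ₗ[ℝ] ℝ) :
    IsScalarization φ (0 : {s : Set X // MeasurableSet s} → E) 0 :=
  ⟨inferInstance, by simp⟩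

variable [Lattice E] [IsOrderedAddMonoid E]

/-- The partial sums increase, so `φ` carries their supremum to the sum of a real series. -/
theorem IsPosMeasure.exists_isScalarization {ν : {s : Set X // MeasurableSet s} → E}
    (hν : IsPosMeasure ν) {φ : E →ₗ[ℝ] ℝ} (hφ : IsPosNormal φ) :
    ∃ m, IsScalarization φ ν m := by
  have happly : ∀ s (hs : MeasurableSet s), Measure.ofMeasurable
      (fun s hs => ENNReal.ofReal (φ (ν ⟨s, hs⟩))) (by rw [hν.empty]; simp)
      (fun Δ hΔ hd => by
        have hmono : Monotone fun N => ∑ n ∈ Finset.range N, φ (ν ⟨Δ n, hΔ n⟩) :=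
          fun M N h => Finset.sum_le_sum_of_subset_of_nonneg (Finset.range_mono h)
            fun n _ _ => hφ.nonneg _ (hν.nonneg _)
        have hmono' : Monotone fun N => ∑ n ∈ Finset.range (N + 1), ν ⟨Δ n, hΔ n⟩ :=
          fun M N h => Finset.sum_le_sum_of_subset_of_nonneg
            (Finset.range_mono (Nat.succ_le_succ h)) fun n _ _ => hν.nonneg _
        have hlub := hφ.map_isLUB _ _ (Set.range_nonempty _) hmono'.directed_le.directedOn_range
          (hν.sigma_additive Δ hΔ hd)
        rw [← Set.range_comp] at hlub
        have hsum : HasSum (fun n => φ (ν ⟨Δ n, hΔ n⟩))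
            (φ (ν ⟨⋃ n, Δ n, MeasurableSet.iUnion hΔ⟩)) := by
          -- `IsPosMeasure` sums over `Finset.range (N + 1)`; an index shift reconciles this with
          -- the usual partial sums.
          rw [hasSum_iff_tendsto_nat_of_nonneg fun n => hφ.nonneg _ (hν.nonneg _),
            ← Filter.tendsto_add_atTop_iff_nat 1]
          refine tendsto_atTop_isLUB (fun M N h => hmono (Nat.succ_le_succ h)) ?_
          simpa only [Function.comp_def, map_sum] using hlub
        rw [← ENNReal.ofReal_tsum_of_nonneg (fun n => hφ.nonneg _ (hν.nonneg _)) hsum.summable,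
          hsum.tsum_eq]) s = ENNReal.ofReal (φ (ν ⟨s, hs⟩)) := fun s hs =>
    Measure.ofMeasurable_apply s hs
  exact ⟨_, ⟨⟨(happly _ MeasurableSet.univ).trans_lt ENNReal.ofReal_lt_top⟩, fun s => by
    rw [measureReal_def, happly s.1 s.2, ENNReal.toReal_ofReal (hφ.nonneg _ (hν.nonneg _))]⟩⟩

variable [IsOrderedModule ℝ E]

/-- Finite additivity is an identity in `E`, tested on each `φ`. It turns the partial sums into
values at the increasing sets `Set.accumulate Δ N`, to which continuity from below of the scalar
measures applies. -/
theorem isPosMeasure_of_forall (hE : IsDedekindComplete E) (hE' : IsNormalVectorLattice E)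
    {ν : {s : Set X // MeasurableSet s} → E} (h0 : ∀ s, 0 ≤ ν s)
    (h : ∀ φ : E →ₗ[ℝ] ℝ, IsPosNormal φ → ∃ m, IsScalarization φ ν m) : IsPosMeasure ν := by
  have hunion : ∀ s t : {s : Set X // MeasurableSet s}, Disjoint s.1 t.1 →
      ν ⟨s.1 ∪ t.1, s.2.union t.2⟩ = ν s + ν t := fun s t hst => hE'.eq_of_forall fun φ hφ => by
    obtain ⟨m, hm⟩ := h φ hφ
    have := hm.isFiniteMeasure
    rw [map_add, ← hm.real_eq, ← hm.real_eq, ← hm.real_eq, measureReal_union hst t.2]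
  have hmono : ∀ s t : {s : Set X // MeasurableSet s}, s.1 ⊆ t.1 → ν s ≤ ν t := by
    intro s t hst
    have h1 := hunion s ⟨t.1 \ s.1, t.2.diff s.2⟩ Set.disjoint_sdiff_right
    simp only [Set.union_sdiff_cancel hst] at h1
    rw [h1]
    exact le_add_of_nonneg_right (h0 _)
  have hempty : ν ⟨∅, MeasurableSet.empty⟩ = 0 := hE'.eq_of_forall fun φ hφ => by
    obtain ⟨m, hm⟩ := h φ hφ
    rw [← hm.real_eq, measureReal_empty, map_zero]
  refine ⟨h0, hempty, fun Δ hΔ hd => ?_⟩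
  have hacc : ∀ N, MeasurableSet (Set.accumulate Δ N) := fun N =>
    MeasurableSet.biUnion (Set.to_countable _) fun n _ => hΔ n
  have hsum : ∀ N, ∑ n ∈ Finset.range (N + 1), ν ⟨Δ n, hΔ n⟩ = ν ⟨Set.accumulate Δ N, hacc N⟩ := by
    intro N
    induction N with
    | zero => simp
    | succ N ih =>
      rw [Finset.sum_range_succ, ih, ← hunion ⟨_, hacc N⟩ ⟨_, hΔ (N + 1)⟩]
      · congr 2
        exact (Set.accumulate_succ Δ N).symm
      · exact Set.disjoint_accumulate hd (Nat.lt_succ_self N)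
  simp only [hsum]
  have hmono' : Monotone fun N => ν ⟨Set.accumulate Δ N, hacc N⟩ := fun M N hMN =>
    hmono _ _ (Set.monotone_accumulate hMN)
  refine isLUB_of_forall_isPosNormal hE hE' (Set.range_nonempty _)
    hmono'.directed_le.directedOn_range ?_ fun φ hφ => ?_
  · rintro _ ⟨N, rfl⟩
    exact hmono _ _ (Set.accumulate_subset_iUnion N)
  · obtain ⟨m, hm⟩ := h φ hφ
    have := hm.isFiniteMeasure
    rw [← Set.range_comp]
    refine isLUB_of_tendsto_atTop (hφ.mono.comp hmono') ?_
    simp only [Function.comp_def, ← hm.real_eq, measureReal_def]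
    exact (ENNReal.tendsto_toReal (measure_ne_top _ _)).comp tendsto_measure_iUnion_accumulate

theorem IsPosMeasure.mono (hE' : IsNormalVectorLattice E)
    {ν : {s : Set X // MeasurableSet s} → E} (hν : IsPosMeasure ν)
    {s t : {s : Set X // MeasurableSet s}} (hst : s.1 ⊆ t.1) : ν s ≤ ν t := by
  have h1 : ν t = ν s + ν ⟨t.1 \ s.1, t.2.diff s.2⟩ := hE'.eq_of_forall fun φ hφ => by
    obtain ⟨m, hm⟩ := hν.exists_isScalarization hφ
    have := hm.isFiniteMeasure
    rw [map_add, ← hm.real_eq, ← hm.real_eq, ← hm.real_eq, measureReal_sdiff hst s.2]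
    ring
  rw [h1]
  exact le_add_of_nonneg_right (hν.nonneg _)

theorem IsPosMeasure.add (hE : IsDedekindComplete E) (hE' : IsNormalVectorLattice E)
    {ν ν' : {s : Set X // MeasurableSet s} → E} (h : IsPosMeasure ν) (h' : IsPosMeasure ν') :
    IsPosMeasure (ν + ν') :=
  isPosMeasure_of_forall hE hE' (fun s => add_nonneg (h.nonneg s) (h'.nonneg s)) fun _ hφ =>
    let ⟨m, hm⟩ := h.exists_isScalarization hφ
    let ⟨m', hm'⟩ := h'.exists_isScalarization hφ
    ⟨m + m', hm.add hm'⟩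

theorem IsPosMeasure.smul (hE : IsDedekindComplete E) (hE' : IsNormalVectorLattice E)
    {ν : {s : Set X // MeasurableSet s} → E} (h : IsPosMeasure ν) (c : ℝ≥0) :
    IsPosMeasure ((c : ℝ) • ν) :=
  isPosMeasure_of_forall hE hE' (fun s => smul_nonneg c.2 (h.nonneg s)) fun _ hφ =>
    let ⟨m, hm⟩ := h.exists_isScalarization hφ
    ⟨c • m, hm.smul c⟩

theorem isPosMeasure_zero (hE : IsDedekindComplete E) (hE' : IsNormalVectorLattice E) :
    IsPosMeasure (0 : {s : Set X // MeasurableSet s} → E) :=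
  isPosMeasure_of_forall hE hE' (fun _ => le_rfl) fun φ _ => ⟨0, isScalarization_zero φ⟩

end Scalarization

/-! ### Regularity of vector measures and of their scalarizations -/

section Regularity

open MeasureTheory

variable {X E : Type*} [TopologicalSpace X] [T2Space X] [MeasurableSpace X] [BorelSpace X]
  [AddCommGroup E] [Lattice E] [IsOrderedAddMonoid E] [Module ℝ E] [IsOrderedModule ℝ E]

theorem isLUB_measureReal_isCompact (m : Measure X)
    [IsFiniteMeasure m] [m.Regular] {U : Set X} (hU : IsOpen U) :
    IsLUB {r | ∃ K : {s : Set X // MeasurableSet s},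
      IsCompact K.1 ∧ K.1 ⊆ U ∧ m.real K.1 = r} (m.real U) := by
  refine ⟨?_, fun b hb => ?_⟩
  · rintro _ ⟨K, -, hKU, rfl⟩
    exact measureReal_mono hKU
  · by_contra! hlt
    have hb0 : 0 ≤ b := by
      simpa using hb ⟨⟨∅, MeasurableSet.empty⟩, isCompact_empty, Set.empty_subset _, rfl⟩
    rw [← ENNReal.ofReal_lt_ofReal_iff (hb0.trans_lt hlt), ofReal_measureReal] at hlt
    obtain ⟨K, hKU, hK, hbK⟩ := hU.exists_lt_isCompact hlt
    rw [← ofReal_measureReal (μ := m)] at hbK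
    exact absurd (ENNReal.ofReal_le_ofReal (hb ⟨⟨K, hK.measurableSet⟩, hK, hKU, rfl⟩))
      (not_le.2 hbK)

omit [T2Space X] in
theorem isGLB_measureReal_isOpen (m : Measure X) [IsFiniteMeasure m] [m.OuterRegular]
    (A : {s : Set X // MeasurableSet s}) : IsGLB {r | ∃ V : {s : Set X // MeasurableSet s},
      IsOpen V.1 ∧ A.1 ⊆ V.1 ∧ m.real V.1 = r} (m.real A.1) := by
  refine ⟨?_, fun b hb => ?_⟩
  · rintro _ ⟨V, -, hAV, rfl⟩
    exact measureReal_mono hAV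
  · by_contra! hlt
    rw [← ENNReal.ofReal_lt_ofReal_iff (measureReal_nonneg.trans_lt hlt), ofReal_measureReal] at hlt
    obtain ⟨V, hAV, hV, hVb⟩ := A.1.exists_isOpen_lt_of_lt _ hlt
    have := hb ⟨⟨V, hV.measurableSet⟩, hV, hAV, rfl⟩
    rw [← ofReal_measureReal (μ := m)] at hVb
    exact absurd (ENNReal.ofReal_le_ofReal this) (not_le.2 hVb)

omit [T2Space X] in
-- Finiteness allows passage between `ℝ` and `ENNReal`: if no open or compact set witnessed
-- regularity at level `r`, then `r.toReal` would be a bound contradicting the supremum or infimum.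
theorem regular_of_isLUB_of_isGLB (m : Measure X) [IsFiniteMeasure m]
    (h : ∀ U : {s : Set X // MeasurableSet s}, IsOpen U.1 →
      IsLUB {r | ∃ K : {s : Set X // MeasurableSet s},
        IsCompact K.1 ∧ K.1 ⊆ U.1 ∧ m.real K.1 = r} (m.real U.1))
    (h' : ∀ A : {s : Set X // MeasurableSet s}, IsGLB {r | ∃ V : {s : Set X // MeasurableSet s},
      IsOpen V.1 ∧ A.1 ⊆ V.1 ∧ m.real V.1 = r} (m.real A.1)) : m.Regular := by
  have houter : m.OuterRegular := ⟨fun A hA r hr => by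
    by_contra! hcon
    rcases eq_or_ne r ⊤ with rfl | hr'
    · exact absurd (hcon _ (Set.subset_univ A) isOpen_univ) (not_le.2 (measure_lt_top m _))
    · have : r.toReal ≤ m.real A := (h' ⟨A, hA⟩).2 (by
        rintro _ ⟨V, hV, hAV, rfl⟩
        exact ENNReal.toReal_mono (measure_ne_top _ _) (hcon _ hAV hV))
      rw [measureReal_def, ENNReal.toReal_le_toReal hr' (measure_ne_top _ _)] at this
      exact absurd this (not_le.2 hr)⟩
  refine ⟨fun U hU r hr => ?_⟩
  by_contra! hcon
  have hr' : r ≠ ⊤ := (hr.trans_le le_top).ne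
  have : m.real U ≤ r.toReal := (h ⟨U, hU.measurableSet⟩ hU).2 (by
    rintro _ ⟨K, hK, hKU, rfl⟩
    exact ENNReal.toReal_mono hr' (hcon _ hKU hK))
  rw [measureReal_def, ENNReal.toReal_le_toReal (measure_ne_top _ _) hr'] at this
  exact absurd this (not_le.2 hr)

/-- A compact set for each measure is replaced by their union, and an open set for each by their
intersection. -/
theorem regular_add (m m' : Measure X) [IsFiniteMeasure m] [IsFiniteMeasure m'] [m.Regular]
    [m'.Regular] : (m + m').Regular := by
  refine regular_of_isLUB_of_isGLB _ (fun U hU => ⟨?_, fun b hb => ?_⟩)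
    fun A => ⟨?_, fun b hb => ?_⟩
  · rintro _ ⟨K, -, hKU, rfl⟩
    exact measureReal_mono hKU
  · rw [measureReal_add_apply]
    refine ((isLUB_measureReal_isCompact m hU).add (isLUB_measureReal_isCompact m' hU)).2 ?_
    rintro _ ⟨_, ⟨K, hK, hKU, rfl⟩, _, ⟨L, hL, hLU, rfl⟩, rfl⟩
    refine le_trans ?_ (hb ⟨⟨K.1 ∪ L.1, K.2.union L.2⟩, hK.union hL, Set.union_subset hKU hLU, rfl⟩)
    rw [measureReal_add_apply]
    exact add_le_add (measureReal_mono Set.subset_union_left)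
      (measureReal_mono Set.subset_union_right)
  · rintro _ ⟨V, -, hAV, rfl⟩
    exact measureReal_mono hAV
  · rw [measureReal_add_apply]
    refine ((isGLB_measureReal_isOpen m A).add (isGLB_measureReal_isOpen m' A)).2 ?_
    rintro _ ⟨_, ⟨V, hV, hAV, rfl⟩, _, ⟨W, hW, hAW, rfl⟩, rfl⟩
    refine (hb ⟨⟨V.1 ∩ W.1, V.2.inter W.2⟩, hV.inter hW, Set.subset_inter hAV hAW, rfl⟩).trans ?_
    rw [measureReal_add_apply]
    exact add_le_add (measureReal_mono Set.inter_subset_left)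
      (measureReal_mono Set.inter_subset_right)

/-- The values at compact subsets are directed upward through unions, and those at open supersets
downward through intersections, so both regularity conditions can be tested on functionals. -/
theorem isPosRegularBorelMeasure_of_forall (hE : IsDedekindComplete E)
    (hE' : IsNormalVectorLattice E) {ν : {s : Set X // MeasurableSet s} → E}
    (h0 : ∀ s, 0 ≤ ν s)
    (h : ∀ φ : E →ₗ[ℝ] ℝ, IsPosNormal φ → ∃ m : Measure X, m.Regular ∧ IsScalarization φ ν m) :
    IsPosRegularBorelMeasure ν := by
  have hν : IsPosMeasure ν := isPosMeasure_of_forall hE hE' h0 fun φ hφ =>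
    let ⟨m, _, hm⟩ := h φ hφ
    ⟨m, hm⟩
  refine ⟨hν, fun U hU => ?_, fun A => ?_⟩
  · refine isLUB_of_forall_isPosNormal hE hE'
      ⟨_, ⟨∅, MeasurableSet.empty⟩, isCompact_empty, Set.empty_subset _, rfl⟩ ?_ ?_ fun φ hφ => ?_
    · rintro _ ⟨K, hK, hKU, rfl⟩ _ ⟨L, hL, hLU, rfl⟩
      exact ⟨_, ⟨⟨K.1 ∪ L.1, K.2.union L.2⟩, hK.union hL, Set.union_subset hKU hLU, rfl⟩,
        hν.mono hE' Set.subset_union_left, hν.mono hE' Set.subset_union_right⟩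
    · rintro _ ⟨K, -, hKU, rfl⟩
      exact hν.mono hE' hKU
    · obtain ⟨m, hreg, hm⟩ := h φ hφ
      have := hm.isFiniteMeasure
      convert isLUB_measureReal_isCompact m hU using 1
      · ext r
        simp [hm.real_eq, and_assoc]
      · exact (hm.real_eq U).symm
  · refine isGLB_of_forall_isPosNormal hE hE'
      ⟨_, ⟨Set.univ, MeasurableSet.univ⟩, isOpen_univ, Set.subset_univ _, rfl⟩ ?_ ?_ fun φ hφ => ?_
    · rintro _ ⟨V, hV, hAV, rfl⟩ _ ⟨W, hW, hAW, rfl⟩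
      exact ⟨_, ⟨⟨V.1 ∩ W.1, V.2.inter W.2⟩, hV.inter hW, Set.subset_inter hAV hAW, rfl⟩,
        hν.mono hE' Set.inter_subset_left, hν.mono hE' Set.inter_subset_right⟩
    · rintro _ ⟨V, -, hAV, rfl⟩
      exact hν.mono hE' hAV
    · obtain ⟨m, hreg, hm⟩ := h φ hφ
      have := hm.isFiniteMeasure
      convert isGLB_measureReal_isOpen m A using 1
      · ext r
        simp [hm.real_eq, and_assoc]
      · exact (hm.real_eq A).symm

omit [T2Space X] in
-- The same directedness lets `φ` carry the regularity conditions of `ν` to `m`.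
theorem IsPosRegularBorelMeasure.regular (hE' : IsNormalVectorLattice E)
    {ν : {s : Set X // MeasurableSet s} → E} (hν : IsPosRegularBorelMeasure ν) {φ : E →ₗ[ℝ] ℝ}
    (hφ : IsPosNormal φ) {m : Measure X} (hm : IsScalarization φ ν m) : m.Regular := by
  have := hm.isFiniteMeasure
  have hmono := @IsPosMeasure.mono _ _ _ _ _ _ _ _ hE' ν hν.isPosMeasure
  refine regular_of_isLUB_of_isGLB m (fun U hU => ?_) fun A => ?_
  · have := hφ.map_isLUB {e | ∃ K : {s : Set X // MeasurableSet s},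
      IsCompact K.1 ∧ K.1 ⊆ U.1 ∧ ν K = e} _
      ⟨_, ⟨∅, MeasurableSet.empty⟩, isCompact_empty, Set.empty_subset _, rfl⟩
      ?_ (hν.innerRegular U hU)
    · convert this using 1
      · ext r
        simp [hm.real_eq, and_assoc]
      · exact hm.real_eq U
    · rintro _ ⟨K, hK, hKU, rfl⟩ _ ⟨L, hL, hLU, rfl⟩
      exact ⟨_, ⟨⟨K.1 ∪ L.1, K.2.union L.2⟩, hK.union hL, Set.union_subset hKU hLU, rfl⟩,
        hmono Set.subset_union_left, hmono Set.subset_union_right⟩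
  · have := hφ.map_isGLB {e | ∃ V : {s : Set X // MeasurableSet s},
      IsOpen V.1 ∧ A.1 ⊆ V.1 ∧ ν V = e} _
      ⟨_, ⟨Set.univ, MeasurableSet.univ⟩, isOpen_univ, Set.subset_univ _, rfl⟩
      ?_ (hν.outerRegular A)
    · convert this using 1
      · ext r
        simp [hm.real_eq, and_assoc]
      · exact hm.real_eq A
    · rintro _ ⟨V, hV, hAV, rfl⟩ _ ⟨W, hW, hAW, rfl⟩
      exact ⟨_, ⟨⟨V.1 ∩ W.1, V.2.inter W.2⟩, hV.inter hW, Set.subset_inter hAV hAW, rfl⟩,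
        hmono Set.inter_subset_left, hmono Set.inter_subset_right⟩

theorem IsPosRegularBorelMeasure.add (hE : IsDedekindComplete E) (hE' : IsNormalVectorLattice E)
    {ν ν' : {s : Set X // MeasurableSet s} → E} (h : IsPosRegularBorelMeasure ν)
    (h' : IsPosRegularBorelMeasure ν') : IsPosRegularBorelMeasure (ν + ν') :=
  isPosRegularBorelMeasure_of_forall hE hE'
    (fun s => add_nonneg (h.isPosMeasure.nonneg s) (h'.isPosMeasure.nonneg s)) fun φ hφ => by
    obtain ⟨m, hm⟩ := h.isPosMeasure.exists_isScalarization hφ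
    obtain ⟨m', hm'⟩ := h'.isPosMeasure.exists_isScalarization hφ
    have := h.regular hE' hφ hm
    have := h'.regular hE' hφ hm'
    have := hm.isFiniteMeasure
    have := hm'.isFiniteMeasure
    exact ⟨m + m', regular_add m m', hm.add hm'⟩

theorem IsPosRegularBorelMeasure.smul (hE : IsDedekindComplete E) (hE' : IsNormalVectorLattice E)
    {ν : {s : Set X // MeasurableSet s} → E} (h : IsPosRegularBorelMeasure ν) (c : ℝ≥0) :
    IsPosRegularBorelMeasure ((c : ℝ) • ν) :=
  isPosRegularBorelMeasure_of_forall hE hE'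
    (fun s => smul_nonneg c.2 (h.isPosMeasure.nonneg s)) fun φ hφ => by
    obtain ⟨m, hm⟩ := h.isPosMeasure.exists_isScalarization hφ
    have := h.regular hE' hφ hm
    exact ⟨c • m, inferInstance, hm.smul c⟩

theorem isPosRegularBorelMeasure_zero (hE : IsDedekindComplete E)
    (hE' : IsNormalVectorLattice E) :
    IsPosRegularBorelMeasure (0 : {s : Set X // MeasurableSet s} → E) :=
  isPosRegularBorelMeasure_of_forall hE hE' (fun _ => le_rfl) fun φ _ =>
    ⟨0, inferInstance, isScalarization_zero φ⟩

/-- The positive regular measures form a convex cone, so their span consists of differences. -/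
theorem mem_regularBorelMeasures_iff (hE : IsDedekindComplete E) (hE' : IsNormalVectorLattice E)
    {μ : {s : Set X // MeasurableSet s} → E} : μ ∈ regularBorelMeasures X E ↔
      ∃ ν₁ ν₂, IsPosRegularBorelMeasure ν₁ ∧ IsPosRegularBorelMeasure ν₂ ∧ μ = ν₁ - ν₂ := by
  constructor
  · intro hμ
    induction hμ using Submodule.span_induction with
    | mem ν hν => exact ⟨ν, 0, hν, isPosRegularBorelMeasure_zero hE hE', (sub_zero ν).symm⟩
    | zero => exact ⟨0, 0, isPosRegularBorelMeasure_zero hE hE',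
        isPosRegularBorelMeasure_zero hE hE', (sub_zero 0).symm⟩
    | add μ μ' _ _ ih ih' =>
      obtain ⟨ν₁, ν₂, h₁, h₂, rfl⟩ := ih
      obtain ⟨ν₁', ν₂', h₁', h₂', rfl⟩ := ih'
      exact ⟨_, _, h₁.add hE hE' h₁', h₂.add hE hE' h₂', by abel⟩
    | smul c μ _ ih =>
      obtain ⟨ν₁, ν₂, h₁, h₂, rfl⟩ := ih
      rcases le_total 0 c with hc | hc
      · exact ⟨_, _, h₁.smul hE hE' ⟨c, hc⟩, h₂.smul hE hE' ⟨c, hc⟩, smul_sub _ _ _⟩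
      · refine ⟨_, _, h₂.smul hE hE' ⟨-c, neg_nonneg.2 hc⟩, h₁.smul hE hE' ⟨-c, neg_nonneg.2 hc⟩, ?_⟩
        change c • (ν₁ - ν₂) = (-c) • ν₂ - (-c) • ν₁
        module
  · rintro ⟨ν₁, ν₂, h₁, h₂, rfl⟩
    exact sub_mem (Submodule.subset_span h₁) (Submodule.subset_span h₂)

end Regularity

/-! ### The order integral and its scalarizations -/

section OrderIntegral

open MeasureTheory

variable {X E : Type*} [MeasurableSpace X] [AddCommGroup E] [Module ℝ E]

theorem IsScalarization.map_sum_smul {φ : E →ₗ[ℝ] ℝ} {ν : {s : Set X // MeasurableSet s} → E}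
    {m : Measure X} (hm : IsScalarization φ ν m) {β : Type*} (q : SimpleFunc X β)
    (g : β → ℝ≥0) :
    φ (∑ b ∈ q.range, (g b : ℝ) • ν ⟨q ⁻¹' {b}, q.measurableSet_fiber b⟩) =
      (∫⁻ x, g (q x) ∂m).toReal := by
  have := hm.isFiniteMeasure
  have h : ∫⁻ x, g (q x) ∂m = ∑ b ∈ q.range, (g b : ENNReal) * m (q ⁻¹' {b}) := by
    rw [← SimpleFunc.map_lintegral, ← SimpleFunc.lintegral_eq_lintegral]
    rfl
  rw [h, ENNReal.toReal_sum fun b _ => ENNReal.mul_ne_top ENNReal.coe_ne_top (measure_ne_top _ _),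
    map_sum]
  refine Finset.sum_congr rfl fun b _ => ?_
  rw [map_smul, ← hm.real_eq, ENNReal.toReal_mul, measureReal_def, smul_eq_mul, ENNReal.coe_toReal]

theorem IsScalarization.map_elementaryIntegral [Lattice E] {φ : E →ₗ[ℝ] ℝ}
    {ν : {s : Set X // MeasurableSet s} → E} {m : Measure X} (hm : IsScalarization φ ν m)
    (s : SimpleFunc X ℝ≥0) : φ (elementaryIntegral ν s) = (∫⁻ x, s x ∂m).toReal :=
  hm.map_sum_smul s id

variable [Lattice E] [IsOrderedAddMonoid E] [IsOrderedModule ℝ E]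

/-- An elementary integral can be computed on any finer partition; monotonicity uses the common
refinement `s.pair t`. -/
theorem IsPosMeasure.elementaryIntegral_map (hE' : IsNormalVectorLattice E)
    {ν : {s : Set X // MeasurableSet s} → E} (hν : IsPosMeasure ν) {β : Type*} (q : SimpleFunc X β)
    (g : β → ℝ≥0) : elementaryIntegral ν (q.map g) =
      ∑ b ∈ q.range, (g b : ℝ) • ν ⟨q ⁻¹' {b}, q.measurableSet_fiber b⟩ :=
  hE'.eq_of_forall fun φ hφ => by
    obtain ⟨m, hm⟩ := hν.exists_isScalarization hφ
    rw [hm.map_sum_smul, hm.map_elementaryIntegral]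
    rfl

theorem IsPosMeasure.elementaryIntegral_mono (hE' : IsNormalVectorLattice E)
    {ν : {s : Set X // MeasurableSet s} → E} (hν : IsPosMeasure ν) :
    Monotone (elementaryIntegral ν) := fun s t hst => by
  have h1 := hν.elementaryIntegral_map hE' (s.pair t) Prod.fst
  have h2 := hν.elementaryIntegral_map hE' (s.pair t) Prod.snd
  rw [SimpleFunc.map_fst_pair] at h1
  rw [SimpleFunc.map_snd_pair] at h2
  rw [h1, h2]
  refine Finset.sum_le_sum fun p hp => ?_
  obtain ⟨x, rfl⟩ := SimpleFunc.mem_range.1 hp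
  exact smul_le_smul_of_nonneg_right (NNReal.coe_le_coe.2 (hst x)) (hν.nonneg _)

theorem elementaryIntegral_le_of_le {ν ν' : {s : Set X // MeasurableSet s} → E} (h : ν ≤ ν')
    (s : SimpleFunc X ℝ≥0) :
    elementaryIntegral ν s ≤ elementaryIntegral ν' s :=
  Finset.sum_le_sum fun r _ => smul_le_smul_of_nonneg_left (h _) r.2

/-- Monotone convergence for `m`; boundedness of `g` keeps the limit finite, so that it survives
`ENNReal.toReal`. -/
theorem HasPosOrderIntegral.map_eq (hE' : IsNormalVectorLattice E)
    {ν : {s : Set X // MeasurableSet s} → E} (hν : IsPosMeasure ν) {φ : E →ₗ[ℝ] ℝ}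
    (hφ : IsPosNormal φ) {m : Measure X} (hm : IsScalarization φ ν m) {g : X → ℝ≥0} {C : ℝ≥0}
    (hC : ∀ x, g x ≤ C) {e : E} (he : HasPosOrderIntegral ν g e) :
    φ e = (∫⁻ x, g x ∂m).toReal := by
  have := hm.isFiniteMeasure
  obtain ⟨s, hs, hsg, hse⟩ := he
  have hmono := (hν.elementaryIntegral_mono hE').comp hs
  have h1 := hφ.map_isLUB _ _ (Set.range_nonempty _) hmono.directed_le.directedOn_range hse
  rw [← Set.range_comp] at h1
  refine tendsto_nhds_unique (tendsto_atTop_isLUB (hφ.mono.comp hmono) h1) ?_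
  simp only [Function.comp_def, hm.map_elementaryIntegral]
  refine (ENNReal.tendsto_toReal ?_).comp (lintegral_tendsto_of_tendsto_of_monotone ?_ ?_ ?_)
  · refine ne_top_of_le_ne_top (b := ∫⁻ _, C ∂m) ?_ (lintegral_mono fun x => ?_)
    · rw [lintegral_const]
      exact ENNReal.mul_ne_top ENNReal.coe_ne_top (measure_ne_top _ _)
    · exact ENNReal.coe_le_coe.2 (hC x)
  · exact fun n => (s n).measurable.coe_nnreal_ennreal.aemeasurable
  · exact Filter.Eventually.of_forall fun x i j hij => ENNReal.coe_le_coe.2 (hs hij x)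
  · exact Filter.Eventually.of_forall fun x => ENNReal.tendsto_coe.2
      (tendsto_atTop_isLUB (fun i j hij => hs hij x) (hsg x))

omit [IsOrderedAddMonoid E] [IsOrderedModule ℝ E] [AddCommGroup E] [Lattice E] [Module ℝ E] in
theorem exists_monotone_simpleFunc_isLUB {g : X → ℝ≥0} (hg : Measurable g) :
    ∃ s : ℕ → SimpleFunc X ℝ≥0, Monotone s ∧ ∀ x, IsLUB (Set.range fun n => s n x) (g x) := by
  refine ⟨fun n => (SimpleFunc.eapprox (fun x => (g x : ENNReal)) n).map ENNReal.toNNReal,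
    fun i j hij x => ENNReal.toNNReal_mono (SimpleFunc.eapprox_lt_top _ _ _).ne
      (SimpleFunc.monotone_eapprox _ hij x), fun x => ?_⟩
  have h := SimpleFunc.iSup_eapprox_apply hg.coe_nnreal_ennreal x
  have h' : IsLUB (Set.range fun n => SimpleFunc.eapprox (fun x => (g x : ENNReal)) n x) (g x) := by
    rw [← h]
    exact isLUB_iSup
  have hcoe : ∀ n, ((ENNReal.toNNReal (SimpleFunc.eapprox (fun x => (g x : ENNReal)) n x) : ℝ≥0) :
      ENNReal) = SimpleFunc.eapprox (fun x => (g x : ENNReal)) n x := fun n =>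
    ENNReal.coe_toNNReal (SimpleFunc.eapprox_lt_top _ _ _).ne
  refine ⟨?_, fun b hb => ?_⟩
  · rintro _ ⟨n, rfl⟩
    rw [← ENNReal.coe_le_coe]
    exact (hcoe n).trans_le (h'.1 ⟨n, rfl⟩)
  · rw [← ENNReal.coe_le_coe]
    refine h'.2 ?_
    rintro _ ⟨n, rfl⟩
    exact (hcoe n).symm.trans_le (ENNReal.coe_le_coe.2 (hb ⟨n, rfl⟩))

theorem IsPosMeasure.exists_isLUB_elementaryIntegral (hE : IsDedekindComplete E)
    (hE' : IsNormalVectorLattice E) {ν : {s : Set X // MeasurableSet s} → E} (hν : IsPosMeasure ν)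
    {s : ℕ → SimpleFunc X ℝ≥0} {C : ℝ≥0} (hC : ∀ n x, s n x ≤ C) :
    ∃ e, IsLUB (Set.range fun n => elementaryIntegral ν (s n)) e := by
  refine hE _ (Set.range_nonempty _) ⟨elementaryIntegral ν (SimpleFunc.const X C), ?_⟩
  rintro _ ⟨n, rfl⟩
  exact hν.elementaryIntegral_mono hE' (hC n)

theorem IsPosMeasure.exists_hasPosOrderIntegral (hE : IsDedekindComplete E)
    (hE' : IsNormalVectorLattice E) {ν : {s : Set X // MeasurableSet s} → E} (hν : IsPosMeasure ν)
    {g : X → ℝ≥0} (hg : Measurable g) {C : ℝ≥0} (hC : ∀ x, g x ≤ C) :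
    ∃ e, HasPosOrderIntegral ν g e := by
  obtain ⟨s, hs, hsg⟩ := exists_monotone_simpleFunc_isLUB hg
  obtain ⟨e, he⟩ := hν.exists_isLUB_elementaryIntegral hE hE'
    (fun n x => ((hsg x).1 ⟨n, rfl⟩).trans (hC x))
  exact ⟨e, s, hs, hsg, he⟩

/-- A bounded measurable real function. -/
def IsBoundedMeasurable (f : X → ℝ) : Prop :=
  Measurable f ∧ ∃ C, ∀ x, |f x| ≤ C

omit [IsOrderedAddMonoid E] [IsOrderedModule ℝ E] [AddCommGroup E] [Lattice E] [Module ℝ E]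

theorem IsBoundedMeasurable.integrable {f : X → ℝ} (hf : IsBoundedMeasurable f) (m : Measure X)
    [IsFiniteMeasure m] : Integrable f m := by
  obtain ⟨hm, C, hC⟩ := hf
  exact Integrable.of_bound hm.aestronglyMeasurable C (Filter.Eventually.of_forall hC)

theorem IsBoundedMeasurable.neg {f : X → ℝ} (hf : IsBoundedMeasurable f) :
    IsBoundedMeasurable fun x => -f x := by
  obtain ⟨hm, C, hC⟩ := hf
  exact ⟨hm.neg, C, fun x => by rw [abs_neg]; exact hC x⟩

theorem IsBoundedMeasurable.exists_toNNReal_le {f : X → ℝ} (hf : IsBoundedMeasurable f) :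
    ∃ C : ℝ≥0, ∀ x, (f x).toNNReal ≤ C := by
  obtain ⟨hm, C, hC⟩ := hf
  exact ⟨C.toNNReal, fun x => Real.toNNReal_mono ((le_abs_self _).trans (hC x))⟩

variable [AddCommGroup E] [Lattice E] [IsOrderedAddMonoid E] [Module ℝ E] [IsOrderedModule ℝ E]

theorem IsPosMeasure.exists_hasOrderIntegral (hE : IsDedekindComplete E)
    (hE' : IsNormalVectorLattice E) {ν₁ ν₂ : {s : Set X // MeasurableSet s} → E}
    (h₁ : IsPosMeasure ν₁) (h₂ : IsPosMeasure ν₂) {f : X → ℝ} (hf : IsBoundedMeasurable f) :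
    ∃ e, HasOrderIntegral (ν₁ - ν₂) f e := by
  obtain ⟨C, hC⟩ := hf.exists_toNNReal_le
  obtain ⟨C', hC'⟩ := hf.neg.exists_toNNReal_le
  obtain ⟨p₁, hp₁⟩ := h₁.exists_hasPosOrderIntegral hE hE' hf.1.real_toNNReal hC
  obtain ⟨n₁, hn₁⟩ := h₁.exists_hasPosOrderIntegral hE hE' hf.neg.1.real_toNNReal hC'
  obtain ⟨p₂, hp₂⟩ := h₂.exists_hasPosOrderIntegral hE hE' hf.1.real_toNNReal hC
  obtain ⟨n₂, hn₂⟩ := h₂.exists_hasPosOrderIntegral hE hE' hf.neg.1.real_toNNReal hC'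
  exact ⟨_, ν₁, ν₂, h₁, h₂, rfl, p₁, n₁, p₂, n₂, hp₁, hn₁, hp₂, hn₂, rfl⟩

theorem HasOrderIntegral.map_eq (hE' : IsNormalVectorLattice E)
    {ν₁ ν₂ : {s : Set X // MeasurableSet s} → E} {φ : E →ₗ[ℝ] ℝ}
    (hφ : IsPosNormal φ) {m₁ m₂ : Measure X} (hm₁ : IsScalarization φ ν₁ m₁)
    (hm₂ : IsScalarization φ ν₂ m₂) {f : X → ℝ} (hf : IsBoundedMeasurable f) {e : E}
    (he : HasOrderIntegral (ν₁ - ν₂) f e) : φ e = ∫ x, f x ∂m₁ - ∫ x, f x ∂m₂ := by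
  obtain ⟨κ₁, κ₂, h₁, h₂, hκ, p₁, n₁, p₂, n₂, hp₁, hn₁, hp₂, hn₂, rfl⟩ := he
  obtain ⟨C, hC⟩ := hf.exists_toNNReal_le
  obtain ⟨C', hC'⟩ := hf.neg.exists_toNNReal_le
  obtain ⟨l₁, hl₁⟩ := h₁.exists_isScalarization hφ
  obtain ⟨l₂, hl₂⟩ := h₂.exists_isScalarization hφ
  have := hm₁.isFiniteMeasure
  have := hm₂.isFiniteMeasure
  have := hl₁.isFiniteMeasure
  have := hl₂.isFiniteMeasure
  -- The decomposition `κ₁ - κ₂` behind `e` may differ from `ν₁ - ν₂`. Adding crosswise gives an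
  -- identity of positive measures, hence of integrals.
  have hsum : m₁ + l₂ = l₁ + m₂ := by
    refine (hm₁.add hl₂).eq ?_
    rw [sub_eq_sub_iff_add_eq_add.1 hκ]
    exact hl₁.add hm₂
  have hint := congrArg (fun m => ∫ x, f x ∂m) hsum
  simp only [integral_add_measure (hf.integrable _) (hf.integrable _)] at hint
  rw [map_sub, map_sub, map_sub, hp₁.map_eq hE' h₁ hφ hl₁ hC, hn₁.map_eq hE' h₁ hφ hl₁ hC',
    hp₂.map_eq hE' h₂ hφ hl₂ hC, hn₂.map_eq hE' h₂ hφ hl₂ hC']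
  have e₁ := integral_eq_lintegral_pos_part_sub_lintegral_neg_part (hf.integrable l₁)
  have e₂ := integral_eq_lintegral_pos_part_sub_lintegral_neg_part (hf.integrable l₂)
  simp only [ENNReal.ofReal] at e₁ e₂
  rw [← e₁, ← e₂]
  linarith

theorem HasOrderIntegral.unique (hE' : IsNormalVectorLattice E)
    {μ : {s : Set X // MeasurableSet s} → E} {f : X → ℝ} (hf : IsBoundedMeasurable f) {e e' : E}
    (he : HasOrderIntegral μ f e) (he' : HasOrderIntegral μ f e') : e = e' :=
  hE'.eq_of_forall fun φ hφ => by
    obtain ⟨ν₁, ν₂, h₁, h₂, rfl, -⟩ := id he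
    obtain ⟨m₁, hm₁⟩ := h₁.exists_isScalarization hφ
    obtain ⟨m₂, hm₂⟩ := h₂.exists_isScalarization hφ
    rw [he.map_eq hE' hφ hm₁ hm₂ hf, he'.map_eq hE' hφ hm₁ hm₂ hf]

theorem HasOrderIntegral.orderIntegral_eq (hE' : IsNormalVectorLattice E)
    {μ : {s : Set X // MeasurableSet s} → E} {f : X → ℝ} (hf : IsBoundedMeasurable f) {e : E}
    (he : HasOrderIntegral μ f e) : orderIntegral μ f = e := by
  have h : ∃ e, HasOrderIntegral μ f e := ⟨e, he⟩
  rw [orderIntegral, dif_pos h]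
  exact h.choose_spec.unique hE' hf he

theorem IsPosMeasure.map_orderIntegral (hE : IsDedekindComplete E) (hE' : IsNormalVectorLattice E)
    {ν₁ ν₂ : {s : Set X // MeasurableSet s} → E} (h₁ : IsPosMeasure ν₁) (h₂ : IsPosMeasure ν₂)
    {φ : E →ₗ[ℝ] ℝ} (hφ : IsPosNormal φ) {m₁ m₂ : Measure X} (hm₁ : IsScalarization φ ν₁ m₁)
    (hm₂ : IsScalarization φ ν₂ m₂) {f : X → ℝ} (hf : IsBoundedMeasurable f) :
    φ (orderIntegral (ν₁ - ν₂) f) = ∫ x, f x ∂m₁ - ∫ x, f x ∂m₂ := by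
  obtain ⟨e, he⟩ := h₁.exists_hasOrderIntegral hE hE' h₂ hf
  rw [he.orderIntegral_eq hE' hf, he.map_eq hE' hφ hm₁ hm₂ hf]

theorem IsPosMeasure.orderIntegral_add_fun (hE : IsDedekindComplete E)
    (hE' : IsNormalVectorLattice E) {ν₁ ν₂ : {s : Set X // MeasurableSet s} → E}
    (h₁ : IsPosMeasure ν₁) (h₂ : IsPosMeasure ν₂) {f g : X → ℝ} (hf : IsBoundedMeasurable f)
    (hg : IsBoundedMeasurable g) (hfg : IsBoundedMeasurable (f + g)) :
    orderIntegral (ν₁ - ν₂) (f + g) = orderIntegral (ν₁ - ν₂) f + orderIntegral (ν₁ - ν₂) g :=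
  hE'.eq_of_forall fun φ hφ => by
    obtain ⟨m₁, hm₁⟩ := h₁.exists_isScalarization hφ
    obtain ⟨m₂, hm₂⟩ := h₂.exists_isScalarization hφ
    have := hm₁.isFiniteMeasure
    have := hm₂.isFiniteMeasure
    rw [map_add]
    simp only [h₁.map_orderIntegral hE hE' h₂ hφ hm₁ hm₂, hf, hg, hfg]
    rw [integral_add' (hf.integrable _) (hg.integrable _),
      integral_add' (hf.integrable _) (hg.integrable _)]
    ring

theorem IsPosMeasure.orderIntegral_smul_fun (hE : IsDedekindComplete E)
    (hE' : IsNormalVectorLattice E) {ν₁ ν₂ : {s : Set X // MeasurableSet s} → E}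
    (h₁ : IsPosMeasure ν₁) (h₂ : IsPosMeasure ν₂) {f : X → ℝ} (hf : IsBoundedMeasurable f) (c : ℝ)
    (hcf : IsBoundedMeasurable (c • f)) :
    orderIntegral (ν₁ - ν₂) (c • f) = c • orderIntegral (ν₁ - ν₂) f :=
  hE'.eq_of_forall fun φ hφ => by
    obtain ⟨m₁, hm₁⟩ := h₁.exists_isScalarization hφ
    obtain ⟨m₂, hm₂⟩ := h₂.exists_isScalarization hφ
    rw [map_smul]
    simp only [h₁.map_orderIntegral hE hE' h₂ hφ hm₁ hm₂, hf, hcf]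
    simp only [Pi.smul_apply, integral_smul, smul_sub]

theorem IsPosMeasure.orderIntegral_add (hE : IsDedekindComplete E)
    (hE' : IsNormalVectorLattice E) {ν₁ ν₂ ν₁' ν₂' : {s : Set X // MeasurableSet s} → E}
    (h₁ : IsPosMeasure ν₁) (h₂ : IsPosMeasure ν₂) (h₁' : IsPosMeasure ν₁')
    (h₂' : IsPosMeasure ν₂') {f : X → ℝ} (hf : IsBoundedMeasurable f) :
    orderIntegral ((ν₁ - ν₂) + (ν₁' - ν₂')) f =
      orderIntegral (ν₁ - ν₂) f + orderIntegral (ν₁' - ν₂') f :=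
  hE'.eq_of_forall fun φ hφ => by
    obtain ⟨m₁, hm₁⟩ := h₁.exists_isScalarization hφ
    obtain ⟨m₂, hm₂⟩ := h₂.exists_isScalarization hφ
    obtain ⟨m₁', hm₁'⟩ := h₁'.exists_isScalarization hφ
    obtain ⟨m₂', hm₂'⟩ := h₂'.exists_isScalarization hφ
    have := hm₁.isFiniteMeasure
    have := hm₂.isFiniteMeasure
    have := hm₁'.isFiniteMeasure
    have := hm₂'.isFiniteMeasure
    rw [map_add, sub_add_sub_comm, (h₁.add hE hE' h₁').map_orderIntegral hE hE' (h₂.add hE hE' h₂')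
      hφ (hm₁.add hm₁') (hm₂.add hm₂') hf, h₁.map_orderIntegral hE hE' h₂ hφ hm₁ hm₂ hf,
      h₁'.map_orderIntegral hE hE' h₂' hφ hm₁' hm₂' hf,
      integral_add_measure (hf.integrable _) (hf.integrable _),
      integral_add_measure (hf.integrable _) (hf.integrable _)]
    ring

theorem IsPosMeasure.orderIntegral_neg (hE : IsDedekindComplete E)
    (hE' : IsNormalVectorLattice E) {ν₁ ν₂ : {s : Set X // MeasurableSet s} → E}
    (h₁ : IsPosMeasure ν₁) (h₂ : IsPosMeasure ν₂) {f : X → ℝ} (hf : IsBoundedMeasurable f) :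
    orderIntegral (-(ν₁ - ν₂)) f = -orderIntegral (ν₁ - ν₂) f :=
  hE'.eq_of_forall fun φ hφ => by
    obtain ⟨m₁, hm₁⟩ := h₁.exists_isScalarization hφ
    obtain ⟨m₂, hm₂⟩ := h₂.exists_isScalarization hφ
    rw [map_neg, neg_sub, h₁.map_orderIntegral hE hE' h₂ hφ hm₁ hm₂ hf,
      h₂.map_orderIntegral hE hE' h₁ hφ hm₂ hm₁ hf, neg_sub]

theorem IsPosMeasure.orderIntegral_smul (hE : IsDedekindComplete E)
    (hE' : IsNormalVectorLattice E) {ν₁ ν₂ : {s : Set X // MeasurableSet s} → E}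
    (h₁ : IsPosMeasure ν₁) (h₂ : IsPosMeasure ν₂) {f : X → ℝ} (hf : IsBoundedMeasurable f)
    (c : ℝ≥0) : orderIntegral ((c : ℝ) • (ν₁ - ν₂)) f = (c : ℝ) • orderIntegral (ν₁ - ν₂) f :=
  hE'.eq_of_forall fun φ hφ => by
    obtain ⟨m₁, hm₁⟩ := h₁.exists_isScalarization hφ
    obtain ⟨m₂, hm₂⟩ := h₂.exists_isScalarization hφ
    rw [map_smul, smul_sub, h₁.map_orderIntegral hE hE' h₂ hφ hm₁ hm₂ hf,
      (h₁.smul hE hE' c).map_orderIntegral hE hE' (h₂.smul hE hE' c) hφ (hm₁.smul c) (hm₂.smul c)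
      hf, integral_smul_nnreal_measure, integral_smul_nnreal_measure, NNReal.smul_def,
      NNReal.smul_def, smul_sub]

/-- The order integral is positive in the measure and the function. -/
theorem IsPosMeasure.orderIntegral_nonneg (hE : IsDedekindComplete E)
    (hE' : IsNormalVectorLattice E) {ν₁ ν₂ : {s : Set X // MeasurableSet s} → E}
    (h₁ : IsPosMeasure ν₁) (h₂ : IsPosMeasure ν₂) (h : ν₂ ≤ ν₁) {f : X → ℝ}
    (hf : IsBoundedMeasurable f) (hf0 : ∀ x, 0 ≤ f x) : 0 ≤ orderIntegral (ν₁ - ν₂) f := by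
  obtain ⟨C, hC⟩ := hf.exists_toNNReal_le
  -- One approximating sequence serves both measures, so that the two integrals compare term by
  -- term.
  obtain ⟨s, hs, hsg⟩ := exists_monotone_simpleFunc_isLUB hf.1.real_toNNReal
  have hsC : ∀ n x, s n x ≤ C := fun n x => ((hsg x).1 ⟨n, rfl⟩).trans (hC x)
  obtain ⟨p₁, hp₁⟩ := h₁.exists_isLUB_elementaryIntegral hE hE' hsC
  obtain ⟨p₂, hp₂⟩ := h₂.exists_isLUB_elementaryIntegral hE hE' hsC
  have hzero : ∀ ν : {s : Set X // MeasurableSet s} → E,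
      HasPosOrderIntegral ν (fun x => (-f x).toNNReal) 0 := fun ν => by
    refine ⟨fun _ => 0, monotone_const, fun x => ?_, ?_⟩
    · change IsLUB (Set.range fun _ : ℕ => (0 : ℝ≥0)) (-f x).toNNReal
      rw [Real.toNNReal_of_nonpos (neg_nonpos.2 (hf0 x)), Set.range_const]
      exact isLUB_singleton
    · rw [Set.range_const]
      convert isLUB_singleton
      refine (Finset.sum_eq_zero fun r hr => ?_).symm
      obtain ⟨x, rfl⟩ := SimpleFunc.mem_range.1 hr
      simp
  have he : HasOrderIntegral (ν₁ - ν₂) f ((p₁ - 0) - (p₂ - 0)) :=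
    ⟨ν₁, ν₂, h₁, h₂, rfl, p₁, 0, p₂, 0, ⟨s, hs, hsg, hp₁⟩, hzero ν₁, ⟨s, hs, hsg, hp₂⟩, hzero ν₂,
      rfl⟩
  rw [he.orderIntegral_eq hE' hf, sub_zero, sub_zero, sub_nonneg]
  refine hp₂.2 ?_
  rintro _ ⟨n, rfl⟩
  exact (elementaryIntegral_le_of_le h (s n)).trans (hp₁.1 ⟨n, rfl⟩)

end OrderIntegral

/-! ### Riesz–Markov representation of positive operators on `C_c(X)` -/

section Representation

open MeasureTheory

variable {X E : Type*} [TopologicalSpace X] [T2Space X] [LocallyCompactSpace X]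

theorem exists_Cc_one_on_tsupport_subset {K U : Set X} (hK : IsCompact K) (hU : IsOpen U)
    (hKU : K ⊆ U) : ∃ f : C_c(X, ℝ), (∀ x, 0 ≤ f x ∧ f x ≤ 1) ∧ tsupport f ⊆ U ∧
      ∀ x ∈ K, f x = 1 := by
  obtain ⟨L, hL, hKL, hLU⟩ := exists_compact_between hK hU hKU
  obtain ⟨f, hf, hf1, hf01⟩ := exists_tsupport_one_of_isOpen_isClosed isOpen_interior
    (hL.closure_of_subset interior_subset) hK.isClosed hKL
  exact ⟨⟨f, HasCompactSupport.intro' hL hL.isClosed fun x hx =>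
      image_eq_zero_of_notMem_tsupport fun h => hx (interior_subset (hf h))⟩,
    hf01, hf.trans (interior_subset.trans hLU), hf1⟩

omit [T2Space X] [LocallyCompactSpace X] in
theorem CompactlySupportedContinuousMap.isBoundedMeasurable [MeasurableSpace X]
    [OpensMeasurableSpace X] (f : C_c(X, ℝ)) : IsBoundedMeasurable f :=
  ⟨f.continuous.measurable, f.hasCompactSupport.exists_bound_of_continuous f.continuous⟩

/-- The values of `T` at the functions between `0` and `1` that are supported in `U`. -/
def valuesBelow (T : C_c(X, ℝ) → E) (U : Set X) : Set E :=
  {e | ∃ f : C_c(X, ℝ), (∀ x, 0 ≤ f x ∧ f x ≤ 1) ∧ tsupport f ⊆ U ∧ T f = e}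

variable [MeasurableSpace X] [BorelSpace X]

/-- Inner regularity reduces `U` to compact `K ⊆ U`, and a Urysohn function equal to `1` on `K` and
supported in `U` bounds the measure of `K`. -/
theorem measureReal_rieszMeasure_isLUB (Λ : C_c(X, ℝ) →ₚ[ℝ] ℝ)
    [IsFiniteMeasure (RealRMK.rieszMeasure Λ)] {U : Set X} (hU : IsOpen U) :
    IsLUB (valuesBelow Λ U) ((RealRMK.rieszMeasure Λ).real U) := by
  refine ⟨?_, fun b hb => ?_⟩
  · rintro _ ⟨f, hf, hfU, rfl⟩
    rw [measureReal_def, ← ENNReal.ofReal_le_iff_le_toReal (measure_ne_top _ _)]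
    exact RealRMK.le_rieszMeasure_tsupport_subset Λ hf hfU
  · have hb0 : 0 ≤ b := hb ⟨0, fun x => ⟨le_rfl, zero_le_one⟩, by simp [tsupport], map_zero Λ⟩
    refine ENNReal.toReal_le_of_le_ofReal hb0 ?_
    rw [hU.measure_eq_iSup_isCompact]
    refine iSup_le fun K => iSup_le fun hKU => iSup_le fun hK => ?_
    obtain ⟨f, hf, hfU, hfK⟩ := exists_Cc_one_on_tsupport_subset hK hU hKU
    exact (RealRMK.rieszMeasure_le_of_eq_one Λ (fun x => (hf x).1) hK hfK).trans
      (ENNReal.ofReal_le_ofReal (hb ⟨f, hf, hfU, rfl⟩))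

theorem isFiniteMeasure_rieszMeasure (Λ : C_c(X, ℝ) →ₚ[ℝ] ℝ) {b : ℝ}
    (hb : ∀ f : C_c(X, ℝ), (∀ x, 0 ≤ f x ∧ f x ≤ 1) → Λ f ≤ b) :
    IsFiniteMeasure (RealRMK.rieszMeasure Λ) := by
  refine ⟨lt_of_le_of_lt (b := ENNReal.ofReal b) ?_ ENNReal.ofReal_lt_top⟩
  rw [isOpen_univ.measure_eq_iSup_isCompact]
  refine iSup_le fun K => iSup_le fun hKU => iSup_le fun hK => ?_
  obtain ⟨f, hf, hfU, hfK⟩ := exists_Cc_one_on_tsupport_subset hK isOpen_univ hKU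
  exact (RealRMK.rieszMeasure_le_of_eq_one Λ (fun x => (hf x).1) hK hfK).trans
    (ENNReal.ofReal_le_ofReal (hb f hf))

variable [AddCommGroup E] [Lattice E] [IsOrderedAddMonoid E] [Module ℝ E] [IsOrderedModule ℝ E]

/-- Positive operators that are bounded on the unit interval are given by integration. -/
theorem exists_isPosRegularBorelMeasure_orderIntegral_eq (hE : IsDedekindComplete E)
    (hE' : IsNormalVectorLattice E) (T : C_c(X, ℝ) →ₗ[ℝ] E) (hT : ∀ f, 0 ≤ f → 0 ≤ T f) {b : E}
    (hb : ∀ f : C_c(X, ℝ), (∀ x, 0 ≤ f x ∧ f x ≤ 1) → T f ≤ b) :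
    ∃ ν : {s : Set X // MeasurableSet s} → E, IsPosRegularBorelMeasure ν ∧
      ∀ f : C_c(X, ℝ), orderIntegral (ν - 0) f = T f := by
  have hTmono : Monotone T := fun f g h => by
    have := hT _ (sub_nonneg.2 h)
    rwa [map_sub, sub_nonneg] at this
  have hzero : ∀ U : Set X, (0 : E) ∈ valuesBelow T U := fun U =>
    ⟨0, fun x => ⟨le_rfl, zero_le_one⟩, by simp [tsupport], map_zero T⟩
  have hex : ∀ U : Set X, ∃ e, IsLUB (valuesBelow T U) e := fun U =>
    hE _ ⟨0, hzero U⟩ ⟨b, by rintro _ ⟨f, hf, -, rfl⟩; exact hb f hf⟩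
  choose ω hω using hex
  have hωmono : ∀ U V : Set X, U ⊆ V → ω U ≤ ω V := fun U V hUV => (hω U).2 (by
    rintro _ ⟨f, hf, hfU, rfl⟩
    exact (hω V).1 ⟨f, hf, hfU.trans hUV, rfl⟩)
  -- `f ⊔ g` is admissible because its support lies in the union of the two supports; `φ` will
  -- preserve only directed suprema.
  have hdir : ∀ U : Set X, DirectedOn (· ≤ ·) (valuesBelow T U) := by
    rintro U _ ⟨f, hf, hfU, rfl⟩ _ ⟨g, hg, hgU, rfl⟩
    refine ⟨_, ⟨f ⊔ g, fun x => ⟨le_sup_of_le_left (hf x).1, sup_le (hf x).2 (hg x).2⟩, ?_, rfl⟩,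
      hTmono le_sup_left, hTmono le_sup_right⟩
    refine closure_minimal (fun x hx => ?_) ((isClosed_tsupport f).union (isClosed_tsupport g))
      |>.trans (Set.union_subset hfU hgU)
    by_contra hcon
    rw [Set.mem_union, not_or] at hcon
    refine hx ?_
    change f x ⊔ g x = 0
    rw [image_eq_zero_of_notMem_tsupport hcon.1, image_eq_zero_of_notMem_tsupport hcon.2, sup_idem]
  have hex' : ∀ A : {s : Set X // MeasurableSet s}, ∃ e,
      IsGLB {e | ∃ V : {s : Set X // MeasurableSet s}, IsOpen V.1 ∧ A.1 ⊆ V.1 ∧ ω V.1 = e} e := by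
    intro A
    have hne : {e | ∃ V : {s : Set X // MeasurableSet s},
        IsOpen V.1 ∧ A.1 ⊆ V.1 ∧ ω V.1 = e}.Nonempty :=
      ⟨_, ⟨Set.univ, MeasurableSet.univ⟩, isOpen_univ, Set.subset_univ _, rfl⟩
    obtain ⟨e, he⟩ := hE _ hne.neg ⟨0, by
      rintro e ⟨V, -, -, h⟩
      rw [← neg_nonneg, ← h]
      exact (hω V.1).1 (hzero _)⟩
    exact ⟨-e, by simpa using he.neg⟩
  choose ν hν using hex'
  have hscal : ∀ φ : E →ₗ[ℝ] ℝ, IsPosNormal φ → ∃ m : Measure X, m.Regular ∧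
      IsScalarization φ ν m ∧ ∀ f : C_c(X, ℝ), ∫ x, f x ∂m = φ (T f) := by
    intro φ hφ
    let Λ : C_c(X, ℝ) →ₚ[ℝ] ℝ :=
      PositiveLinearMap.mk₀ (φ ∘ₗ T) fun f hf => hφ.nonneg _ (hT f hf)
    have hfin : IsFiniteMeasure (RealRMK.rieszMeasure Λ) :=
      isFiniteMeasure_rieszMeasure Λ (b := φ b) fun f hf => hφ.mono (hb f hf)
    refine ⟨RealRMK.rieszMeasure Λ, inferInstance, ⟨hfin, fun A => ?_⟩, fun f =>
      RealRMK.integral_rieszMeasure Λ f⟩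
    -- On open sets `φ ∘ ω` is the supremum of `Λ f` that defines the Riesz–Markov measure; outer
    -- regularity extends the agreement to `φ ∘ ν` on all Borel sets.
    have hopen : ∀ U : Set X, IsOpen U → φ (ω U) = (RealRMK.rieszMeasure Λ).real U := by
      intro U hU
      refine (hφ.map_isLUB _ _ ⟨0, hzero U⟩ (hdir U) (hω U)).unique ?_
      have hset : φ '' valuesBelow T U = valuesBelow Λ U := by
        ext r
        constructor
        · rintro ⟨_, ⟨f, hf, hfU, rfl⟩, rfl⟩
          exact ⟨f, hf, hfU, rfl⟩
        · rintro ⟨f, hf, hfU, rfl⟩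
          exact ⟨_, ⟨f, hf, hfU, rfl⟩, rfl⟩
      rw [hset]
      exact measureReal_rieszMeasure_isLUB Λ hU
    have h1 := hφ.map_isGLB {e | ∃ V : {s : Set X // MeasurableSet s},
      IsOpen V.1 ∧ A.1 ⊆ V.1 ∧ ω V.1 = e} _
      ⟨_, ⟨Set.univ, MeasurableSet.univ⟩, isOpen_univ, Set.subset_univ _, rfl⟩ (by
        rintro _ ⟨V, hV, hAV, rfl⟩ _ ⟨W, hW, hAW, rfl⟩
        exact ⟨_, ⟨⟨V.1 ∩ W.1, V.2.inter W.2⟩, hV.inter hW, Set.subset_inter hAV hAW, rfl⟩,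
          hωmono _ _ Set.inter_subset_left, hωmono _ _ Set.inter_subset_right⟩) (hν A)
    refine (isGLB_measureReal_isOpen (RealRMK.rieszMeasure Λ) A).unique ?_
    have hset : {r | ∃ V : {s : Set X // MeasurableSet s}, IsOpen V.1 ∧ A.1 ⊆ V.1 ∧
        (RealRMK.rieszMeasure Λ).real V.1 = r} = φ '' {e | ∃ V : {s : Set X // MeasurableSet s},
          IsOpen V.1 ∧ A.1 ⊆ V.1 ∧ ω V.1 = e} := by
      ext r
      constructor
      · rintro ⟨V, hV, hAV, rfl⟩
        exact ⟨_, ⟨V, hV, hAV, rfl⟩, hopen _ hV⟩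
      · rintro ⟨_, ⟨V, hV, hAV, rfl⟩, rfl⟩
        exact ⟨V, hV, hAV, (hopen _ hV).symm⟩
    rw [hset]
    exact h1
  have hreg : IsPosRegularBorelMeasure ν := by
    refine isPosRegularBorelMeasure_of_forall hE hE' (fun A => (hν A).2 ?_) fun φ hφ =>
      let ⟨m, hm, hm', _⟩ := hscal φ hφ
      ⟨m, hm, hm'⟩
    rintro _ ⟨V, -, -, rfl⟩
    exact (hω V.1).1 (hzero _)
  refine ⟨ν, hreg, fun f => hE'.eq_of_forall fun φ hφ => ?_⟩
  obtain ⟨m, -, hm, hint⟩ := hscal φ hφ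
  rw [hreg.isPosMeasure.map_orderIntegral hE hE' (isPosMeasure_zero hE hE') hφ hm
    (isScalarization_zero φ) f.isBoundedMeasurable, hint, integral_zero_measure, sub_zero]

/-- Regular Borel measures are determined by the integrals of functions with compact support. -/
theorem IsPosRegularBorelMeasure.eq_of_orderIntegral_eq_zero (hE : IsDedekindComplete E)
    (hE' : IsNormalVectorLattice E) {ν₁ ν₂ : {s : Set X // MeasurableSet s} → E}
    (h₁ : IsPosRegularBorelMeasure ν₁) (h₂ : IsPosRegularBorelMeasure ν₂)
    (h : ∀ f : C_c(X, ℝ), orderIntegral (ν₁ - ν₂) f = 0) : ν₁ = ν₂ :=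
  funext fun s => hE'.eq_of_forall fun φ hφ => by
    obtain ⟨m₁, hm₁⟩ := h₁.isPosMeasure.exists_isScalarization hφ
    obtain ⟨m₂, hm₂⟩ := h₂.isPosMeasure.exists_isScalarization hφ
    have := h₁.regular hE' hφ hm₁
    have := h₂.regular hE' hφ hm₂
    have heq : m₁ = m₂ := Measure.ext_of_integral_eq_on_compactlySupported fun f => by
      have := congrArg φ (h f)
      rwa [h₁.isPosMeasure.map_orderIntegral hE hE' h₂.isPosMeasure hφ hm₁ hm₂
        f.isBoundedMeasurable, map_zero, sub_eq_zero] at this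
    rw [← hm₁.real_eq, ← hm₂.real_eq, heq]

end Representation

/-! ### Uniform norm and order on `C_c(X)` and `C₀(X)` -/

section FunctionSpaceInstances

variable {X : Type*} [TopologicalSpace X]

instance : IsOrderedModule ℝ C_c(X, ℝ) :=
  IsOrderedModule.of_smul_nonneg fun _ hc _ hf x => mul_nonneg hc (hf x)

instance : IsOrderedModule ℝ C₀(X, ℝ) where
  smul_le_smul_of_nonneg_left _ hc _ _ h x := mul_le_mul_of_nonneg_left (h x) hc
  smul_le_smul_of_nonneg_right _ hf _ _ h x := mul_le_mul_of_nonneg_right h (hf x)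

theorem ZeroAtInftyContinuousMap.norm_le_iff (f : C₀(X, ℝ)) {C : ℝ} (hC : 0 ≤ C) :
    ‖f‖ ≤ C ↔ ∀ x, |f x| ≤ C := by
  rw [← ZeroAtInftyContinuousMap.norm_toBCF_eq_norm, BoundedContinuousFunction.norm_le hC]
  rfl

theorem CompactlySupportedContinuousMap.norm_le_iff (f : C_c(X, ℝ)) {C : ℝ} (hC : 0 ≤ C) :
    ‖f‖ ≤ C ↔ ∀ x, |f x| ≤ C :=
  ZeroAtInftyContinuousMap.norm_le_iff (toZeroAtInftyReal f) hC

theorem ZeroAtInftyContinuousMap.abs_apply_le_norm (f : C₀(X, ℝ)) (x : X) : |f x| ≤ ‖f‖ :=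
  (f.norm_le_iff (norm_nonneg f)).1 le_rfl x

theorem CompactlySupportedContinuousMap.abs_apply_le_norm (f : C_c(X, ℝ)) (x : X) :
    |f x| ≤ ‖f‖ :=
  (f.norm_le_iff (norm_nonneg f)).1 le_rfl x

instance : HasSolidNorm C₀(X, ℝ) where
  solid f g h := (f.norm_le_iff (norm_nonneg g)).2 fun x => (h x).trans (g.abs_apply_le_norm x)

instance : HasSolidNorm C_c(X, ℝ) where
  solid f g h := (f.norm_le_iff (norm_nonneg g)).2 fun x => (h x).trans (g.abs_apply_le_norm x)

theorem ZeroAtInftyContinuousMap.isBoundedMeasurable [MeasurableSpace X]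
    [OpensMeasurableSpace X] (f : C₀(X, ℝ)) : IsBoundedMeasurable f :=
  ⟨f.continuous.measurable, _, f.abs_apply_le_norm⟩

/-- Functions with compact support are dense in `C₀(X, ℝ)`. -/
theorem ZeroAtInftyContinuousMap.exists_norm_sub_toZeroAtInftyReal_le [R1Space X] (f : C₀(X, ℝ))
    {ε : ℝ} (hε : 0 < ε) :
    ∃ g : C_c(X, ℝ), ‖f - CompactlySupportedContinuousMap.toZeroAtInftyReal g‖ ≤ ε := by
  have hev : ∀ᶠ x in Filter.cocompact X, |f x| < ε := by
    have := (zero_at_infty f).eventually (Metric.ball_mem_nhds 0 hε)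
    simpa using this
  obtain ⟨K, hK, hKf⟩ := Filter.mem_cocompact.1 hev
  -- Removing from `f` its truncation to `[-ε, ε]` leaves a function that vanishes off `K`.
  let g : C_c(X, ℝ) := ⟨⟨fun x => f x - max (-ε) (min ε (f x)), by fun_prop⟩,
    HasCompactSupport.intro hK fun x hx => by
      have h : -ε < f x ∧ f x < ε := abs_lt.1 (hKf hx)
      change f x - max (-ε) (min ε (f x)) = 0
      rw [min_eq_right h.2.le, max_eq_right h.1.le, sub_self]⟩
  refine ⟨g, (norm_le_iff _ hε.le).2 fun x => ?_⟩
  change |f x - (f x - max (-ε) (min ε (f x)))| ≤ ε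
  rw [sub_sub_cancel, abs_le]
  exact ⟨le_max_left _ _, max_le (by linarith) (min_le_left _ _)⟩

end FunctionSpaceInstances

/-! ### Transport of vector lattice structure along order isomorphisms -/

section VectorLattices

variable {V W : Type*} [AddCommGroup V] [Module ℝ V] [PartialOrder V]
  [AddCommGroup W] [Module ℝ W] [PartialOrder W]

theorem isVectorLattice_of_exists_sup (hadd : ∀ u v w : V, u ≤ v → u + w ≤ v + w)
    (hsmul : ∀ (r : ℝ) (v : V), 0 ≤ r → 0 ≤ v → 0 ≤ r • v)
    (hsup : ∀ u v : V, ∃ s, IsLUB {u, v} s) : IsVectorLattice V := by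
  refine ⟨hadd, hsmul, hsup, fun u v => ?_⟩
  have : IsOrderedAddMonoid V := { add_le_add_left := fun u v h w => hadd u v w h }
  obtain ⟨s, hs⟩ := hsup (-u) (-v)
  exact ⟨-s, by simpa [Set.neg_insert] using hs.neg⟩

/-- Suprema and infima depend on the order alone, so a linear bijection that preserves and reflects
it transfers them, and with them the lattice axioms from `W` to `V`. -/
theorem isVectorLatticeIso_of_le_iff (Φ : V →ₗ[ℝ] W) (hΦ : Function.Bijective Φ)
    (hle : ∀ u v, Φ u ≤ Φ v ↔ u ≤ v) (hW : IsVectorLattice W) : IsVectorLatticeIso Φ := by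
  let e : V ≃o W := { Equiv.ofBijective Φ hΦ with map_rel_iff' := hle _ _ }
  have hlub : ∀ u v s : V, IsLUB {Φ u, Φ v} (Φ s) ↔ IsLUB {u, v} s := fun u v s => by
    rw [← e.isLUB_image', Set.image_pair]
    rfl
  have hglb : ∀ u v s : V, IsGLB {Φ u, Φ v} (Φ s) ↔ IsGLB {u, v} s := fun u v s => by
    rw [← e.isGLB_image', Set.image_pair]
    rfl
  refine ⟨⟨fun u v w h => ?_, fun r v hr hv => ?_, fun u v => ?_, fun u v => ?_⟩, hW, hΦ,
    fun u v s h => (hlub u v s).2 h, fun u v s h => (hglb u v s).2 h⟩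
  · rw [← hle, map_add, map_add]
    exact hW.add_le_add _ _ _ ((hle _ _).2 h)
  · rw [← hle, map_zero, map_smul]
    refine hW.smul_nonneg _ _ hr ?_
    rwa [← map_zero Φ, hle]
  · obtain ⟨s, hs⟩ := hW.exists_sup (Φ u) (Φ v)
    obtain ⟨s, rfl⟩ := hΦ.2 s
    exact ⟨s, (hlub u v s).1 hs⟩
  · obtain ⟨s, hs⟩ := hW.exists_inf (Φ u) (Φ v)
    obtain ⟨s, rfl⟩ := hΦ.2 s
    exact ⟨s, (hglb u v s).1 hs⟩

end VectorLattices

/-! ### The vector lattice of norm to order bounded operators -/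

section NormToOrderBounded

variable {F E : Type*} [AddCommGroup E] [Lattice E] [IsOrderedAddMonoid E] [Module ℝ E]
  [IsOrderedModule ℝ E] [NormedAddCommGroup F] [Module ℝ F]

theorem mem_normToOrderBounded_of_forall {T : F →ₗ[ℝ] E}
    (h : ∀ r : ℝ, 0 ≤ r → ∃ a b, ∀ f, ‖f‖ ≤ r → T f ≤ a ∧ b ≤ T f) :
    T ∈ normToOrderBounded F E := by
  intro S hS
  obtain ⟨r, hr⟩ := isBounded_iff_forall_norm_le.1 hS
  obtain ⟨a, b, hab⟩ := h (max r 0) (le_max_right _ _)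
  constructor
  · refine ⟨a, ?_⟩
    rintro _ ⟨f, hf, rfl⟩
    exact (hab f ((hr f hf).trans (le_max_left _ _))).1
  · refine ⟨b, ?_⟩
    rintro _ ⟨f, hf, rfl⟩
    exact (hab f ((hr f hf).trans (le_max_left _ _))).2

theorem exists_bounds_of_mem_normToOrderBounded {T : F →ₗ[ℝ] E}
    (hT : T ∈ normToOrderBounded F E) (r : ℝ) :
    ∃ a b, ∀ f, ‖f‖ ≤ r → T f ≤ a ∧ b ≤ T f := by
  obtain ⟨⟨a, ha⟩, ⟨b, hb⟩⟩ := hT {f | ‖f‖ ≤ r} (isBounded_iff_forall_norm_le.2 ⟨r, fun _ h => h⟩)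
  exact ⟨a, b, fun f hf => ⟨ha ⟨f, hf, rfl⟩, hb ⟨f, hf, rfl⟩⟩⟩

variable [Lattice F] [HasSolidNorm F] [IsOrderedAddMonoid F] [IsOrderedModule ℝ F]

/-- By solidity of the norm, `[0, f]` lies in the ball of radius `‖f‖`. An upper bound `a` of `T` on
a ball thus bounds `P` on its positive elements, and splitting `f` as `f⁺ - f⁻` gives the bounds `a`
and `-a` on the whole ball. -/
theorem exists_posPart_mem_normToOrderBounded (hE : IsDedekindComplete E) {T : F →ₗ[ℝ] E}
    (hT : T ∈ normToOrderBounded F E) : ∃ P ∈ normToOrderBounded F E,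
      ∀ f, 0 ≤ f → IsLUB (T '' Set.Icc 0 f) (P f) := by
  have hnorm : ∀ f g : F, 0 ≤ g → g ≤ f → ‖g‖ ≤ ‖f‖ := fun f g hg hgf =>
    HasSolidNorm.solid (by rwa [abs_of_nonneg hg, abs_of_nonneg (hg.trans hgf)])
  obtain ⟨P, hP⟩ := exists_posPart_operator hE T fun f hf => by
    obtain ⟨a, b, hab⟩ := exists_bounds_of_mem_normToOrderBounded hT ‖f‖
    refine ⟨a, ?_⟩
    rintro _ ⟨g, hg, rfl⟩
    exact (hab g (hnorm f g hg.1 hg.2)).1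
  refine ⟨P, mem_normToOrderBounded_of_forall fun r hr => ?_, hP⟩
  obtain ⟨a, b, hab⟩ := exists_bounds_of_mem_normToOrderBounded hT r
  have hle : ∀ f : F, 0 ≤ f → ‖f‖ ≤ r → P f ≤ a := fun f hf hfr => (hP f hf).2 (by
    rintro _ ⟨g, hg, rfl⟩
    exact (hab g ((hnorm f g hg.1 hg.2).trans hfr)).1)
  have hpos : ∀ f : F, 0 ≤ f → 0 ≤ P f := fun f hf => (hP f hf).1 ⟨0, ⟨le_rfl, hf⟩, map_zero T⟩
  refine ⟨a, -a, fun f hf => ?_⟩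
  have h1 := hle f⁺ (posPart_nonneg f) (le_trans (HasSolidNorm.solid (by
    rw [abs_of_nonneg (posPart_nonneg f)]
    exact sup_le (le_abs_self f) (abs_nonneg f))) hf)
  have h2 := hle f⁻ (negPart_nonneg f) (le_trans (HasSolidNorm.solid (by
    rw [abs_of_nonneg (negPart_nonneg f)]
    exact sup_le (neg_le_abs f) (abs_nonneg f))) hf)
  rw [← posPart_sub_negPart f, map_sub]
  exact ⟨(sub_le_self _ (hpos _ (negPart_nonneg f))).trans h1,
    (neg_le_neg h2).trans (by
      rw [neg_eq_zero_sub]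
      exact sub_le_sub_right (hpos _ (posPart_nonneg f)) _)⟩

/-- Norm to order bounded operators are differences of positive ones. -/
theorem exists_pos_sub_pos_of_mem_normToOrderBounded (hE : IsDedekindComplete E) {T : F →ₗ[ℝ] E}
    (hT : T ∈ normToOrderBounded F E) : ∃ P ∈ normToOrderBounded F E,
      ∃ Q ∈ normToOrderBounded F E,
        (∀ f, 0 ≤ f → 0 ≤ P f) ∧ (∀ f, 0 ≤ f → 0 ≤ Q f) ∧ T = P - Q := by
  obtain ⟨P, hPmem, hP⟩ := exists_posPart_mem_normToOrderBounded hE hT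
  exact ⟨P, hPmem, P - T, sub_mem hPmem hT,
    fun f hf => (hP f hf).1 ⟨0, ⟨le_rfl, hf⟩, map_zero T⟩,
    fun f hf => sub_nonneg.2 ((hP f hf).1 ⟨f, ⟨hf, le_rfl⟩, rfl⟩), by abel⟩

theorem isVectorLattice_normToOrderBounded (hE : IsDedekindComplete E) :
    IsVectorLattice (normToOrderBounded F E) := by
  refine isVectorLattice_of_exists_sup (fun S T R h f hf => ?_) (fun r T hr hT f hf => ?_)
    fun S T => ?_
  · exact add_le_add_left (h f hf) _
  · exact smul_nonneg hr (hT f hf)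
  -- The supremum of `S` and `T` is `S + (T - S)⁺`.
  · obtain ⟨P, hPmem, hP⟩ := exists_posPart_mem_normToOrderBounded hE (sub_mem T.2 S.2)
    refine ⟨S + ⟨P, hPmem⟩, ?_, fun R hR f hf => ?_⟩
    · rintro _ (rfl | rfl) f hf
      · exact le_add_of_nonneg_right ((hP f hf).1 ⟨0, ⟨le_rfl, hf⟩, map_zero _⟩)
      · exact sub_le_iff_le_add'.1 ((hP f hf).1 ⟨f, ⟨hf, le_rfl⟩, rfl⟩)
    · refine le_sub_iff_add_le'.1 ((hP f hf).2 ?_)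
      rintro _ ⟨g, hg, rfl⟩
      have h1 := hR (Set.mem_insert_of_mem _ rfl) g hg.1
      -- Positivity of `R - S` at `f - g` makes `R - S` larger at `f` than at `g`.
      have h2 := hR (Set.mem_insert _ _) (f - g) (sub_nonneg.2 hg.2)
      rw [map_sub, map_sub] at h2
      calc T.1 g - S.1 g ≤ R.1 g - S.1 g := sub_le_sub_right h1 _
        _ ≤ R.1 f - S.1 f := by
          rw [sub_le_sub_iff] at h2 ⊢
          rw [add_comm (R.1 g), add_comm (R.1 f)]
          rwa [add_comm (R.1 f)] at h2

end NormToOrderBounded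

/-! ### The linear map `μ ↦ I_μ` -/

section OrderIntegralOperator

open MeasureTheory

variable {X E : Type*} [MeasurableSpace X] [AddCommGroup E] [Lattice E] [IsOrderedAddMonoid E]
  [Module ℝ E] [IsOrderedModule ℝ E]

theorem isBoundedMeasurable_const (r : ℝ) : IsBoundedMeasurable fun _ : X => r :=
  ⟨measurable_const, |r|, fun _ => le_rfl⟩

theorem IsBoundedMeasurable.add {f g : X → ℝ} (hf : IsBoundedMeasurable f)
    (hg : IsBoundedMeasurable g) : IsBoundedMeasurable (f + g) := by
  obtain ⟨hfm, C, hC⟩ := hf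
  obtain ⟨hgm, D, hD⟩ := hg
  exact ⟨hfm.add hgm, C + D, fun x => (abs_add_le _ _).trans (add_le_add (hC x) (hD x))⟩

/-- The functions `r - f` and `r + f` are nonnegative, so their integrals are too. -/
theorem IsPosMeasure.orderIntegral_bounds (hE : IsDedekindComplete E)
    (hE' : IsNormalVectorLattice E) {ν : {s : Set X // MeasurableSet s} → E} (hν : IsPosMeasure ν)
    {f : X → ℝ} (hf : IsBoundedMeasurable f) {r : ℝ} (hr : ∀ x, |f x| ≤ r) :
    orderIntegral (ν - 0) f ≤ orderIntegral (ν - 0) (fun _ => r) ∧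
      -orderIntegral (ν - 0) (fun _ => r) ≤ orderIntegral (ν - 0) f := by
  have h0 : IsPosMeasure (0 : {s : Set X // MeasurableSet s} → E) := isPosMeasure_zero hE hE'
  have hcr := isBoundedMeasurable_const (X := X) r
  have hneg : IsBoundedMeasurable ((fun _ : X => r) + fun x => -f x) := hcr.add hf.neg
  constructor
  · have h1 := hν.orderIntegral_add_fun hE hE' h0 hf hneg (hf.add hneg)
    have h2 : f + ((fun _ : X => r) + fun x => -f x) = fun _ => r := by
      ext x
      simp
    rw [h2] at h1
    rw [h1]
    refine le_add_of_nonneg_right (hν.orderIntegral_nonneg hE hE' h0 hν.nonneg hneg fun x => ?_)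
    have := (abs_le.1 (hr x)).2
    simp only [Pi.add_apply]
    linarith
  · rw [neg_le_iff_add_nonneg, ← hν.orderIntegral_add_fun hE hE' h0 hf hcr (hf.add hcr)]
    refine hν.orderIntegral_nonneg hE hE' h0 hν.nonneg (hf.add hcr) fun x => ?_
    have := (abs_le.1 (hr x)).1
    simp only [Pi.add_apply]
    linarith

theorem IsPosMeasure.orderIntegral_sub (hE : IsDedekindComplete E)
    (hE' : IsNormalVectorLattice E) {ν₁ ν₂ : {s : Set X // MeasurableSet s} → E}
    (h₁ : IsPosMeasure ν₁) (h₂ : IsPosMeasure ν₂) {f : X → ℝ} (hf : IsBoundedMeasurable f) :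
    orderIntegral (ν₁ - ν₂) f = orderIntegral (ν₁ - 0) f - orderIntegral (ν₂ - 0) f := by
  have h0 : IsPosMeasure (0 : {s : Set X // MeasurableSet s} → E) := isPosMeasure_zero hE hE'
  rw [sub_eq_add_neg (orderIntegral (ν₁ - 0) f), ← h₂.orderIntegral_neg hE hE' h0 hf, neg_sub,
    ← h₁.orderIntegral_add hE hE' h0 h0 h₂ hf]
  congr 1
  abel

variable {F : Type*} [NormedAddCommGroup F] [Module ℝ F]

/-- The operator `f ↦ I_μ(f)` on a normed space `F` of bounded measurable functions. -/
theorem IsPosMeasure.exists_orderIntegral_operator (hE : IsDedekindComplete E)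
    (hE' : IsNormalVectorLattice E) (ι : F →ₗ[ℝ] X → ℝ) (hι : ∀ f, IsBoundedMeasurable (ι f))
    (hnorm : ∀ f x, |ι f x| ≤ ‖f‖) {ν₁ ν₂ : {s : Set X // MeasurableSet s} → E}
    (h₁ : IsPosMeasure ν₁) (h₂ : IsPosMeasure ν₂) :
    ∃ T ∈ normToOrderBounded F E, ∀ f, T f = orderIntegral (ν₁ - ν₂) (ι f) := by
  refine ⟨{
    toFun := fun f => orderIntegral (ν₁ - ν₂) (ι f)
    map_add' := fun f g => ?_
    map_smul' := fun c f => ?_ }, mem_normToOrderBounded_of_forall fun r _ =>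
      ⟨orderIntegral (ν₁ - 0) (fun _ => r) + orderIntegral (ν₂ - 0) (fun _ => r),
        -(orderIntegral (ν₁ - 0) (fun _ => r) + orderIntegral (ν₂ - 0) (fun _ => r)),
        fun f hf => ?_⟩, fun f => rfl⟩
  · rw [map_add, h₁.orderIntegral_add_fun hE hE' h₂ (hι f) (hι g) (map_add ι f g ▸ hι (f + g))]
  · rw [map_smul, h₁.orderIntegral_smul_fun hE hE' h₂ (hι f) c (map_smul ι c f ▸ hι (c • f))]
    rfl
  · have hfr : ∀ x, |ι f x| ≤ r := fun x => (hnorm f x).trans hf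
    obtain ⟨a₁, b₁⟩ := h₁.orderIntegral_bounds hE hE' (hι f) hfr
    obtain ⟨a₂, b₂⟩ := h₂.orderIntegral_bounds hE hE' (hι f) hfr
    change orderIntegral (ν₁ - ν₂) (ι f) ≤ _ ∧ _ ≤ orderIntegral (ν₁ - ν₂) (ι f)
    rw [h₁.orderIntegral_sub hE hE' h₂ (hι f), neg_add, ← sub_eq_add_neg (-_)]
    refine ⟨?_, sub_le_sub b₁ a₂⟩
    rw [sub_eq_add_neg]
    exact add_le_add a₁ (neg_le.1 b₂)

variable [TopologicalSpace X] [T2Space X] [BorelSpace X]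

/-- The map `μ ↦ I_μ`. -/
theorem exists_orderIntegral_linearMap (hE : IsDedekindComplete E)
    (hE' : IsNormalVectorLattice E) (ι : F →ₗ[ℝ] X → ℝ) (hι : ∀ f, IsBoundedMeasurable (ι f))
    (hnorm : ∀ f x, |ι f x| ≤ ‖f‖) :
    ∃ Φ : regularBorelMeasures X E →ₗ[ℝ] normToOrderBounded F E,
      ∀ μ f, (Φ μ : F →ₗ[ℝ] E) f = orderIntegral μ.1 (ι f) := by
  have hex : ∀ μ : regularBorelMeasures X E, ∃ T : normToOrderBounded F E,
      ∀ f, (T : F →ₗ[ℝ] E) f = orderIntegral μ.1 (ι f) := by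
    rintro ⟨μ, hμ⟩
    obtain ⟨ν₁, ν₂, h₁, h₂, rfl⟩ := (mem_regularBorelMeasures_iff hE hE').1 hμ
    obtain ⟨T, hT, h⟩ := h₁.isPosMeasure.exists_orderIntegral_operator hE hE' ι hι hnorm
      h₂.isPosMeasure
    exact ⟨⟨T, hT⟩, h⟩
  choose Φ hΦ using hex
  refine ⟨{ toFun := Φ, map_add' := ?_, map_smul' := ?_ }, hΦ⟩
  · rintro ⟨μ, hμ⟩ ⟨μ', hμ'⟩
    refine Subtype.ext (LinearMap.ext fun f => ?_)
    change (Φ _).1 f = (Φ _).1 f + (Φ _).1 f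
    rw [hΦ, hΦ, hΦ]
    obtain ⟨ν₁, ν₂, h₁, h₂, rfl⟩ := (mem_regularBorelMeasures_iff hE hE').1 hμ
    obtain ⟨ν₁', ν₂', h₁', h₂', rfl⟩ := (mem_regularBorelMeasures_iff hE hE').1 hμ'
    exact h₁.isPosMeasure.orderIntegral_add hE hE' h₂.isPosMeasure h₁'.isPosMeasure
      h₂'.isPosMeasure (hι f)
  · rintro c ⟨μ, hμ⟩
    refine Subtype.ext (LinearMap.ext fun f => ?_)
    change (Φ _).1 f = c • (Φ _).1 f
    rw [hΦ, hΦ]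
    obtain ⟨ν₁, ν₂, h₁, h₂, rfl⟩ := (mem_regularBorelMeasures_iff hE hE').1 hμ
    change orderIntegral (c • (ν₁ - ν₂)) (ι f) = c • orderIntegral (ν₁ - ν₂) (ι f)
    -- For `c ≤ 0`, the multiple `c • (ν₁ - ν₂)` is the nonnegative multiple `(-c) • (ν₂ - ν₁)` of
    -- the swapped difference.
    rcases le_total 0 c with hc | hc
    · exact h₁.isPosMeasure.orderIntegral_smul hE hE' h₂.isPosMeasure (hι f) ⟨c, hc⟩
    · have h := h₂.isPosMeasure.orderIntegral_smul hE hE' h₁.isPosMeasure (hι f)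
        ⟨-c, neg_nonneg.2 hc⟩
      change orderIntegral ((-c) • (ν₂ - ν₁)) (ι f) = (-c) • orderIntegral (ν₂ - ν₁) (ι f) at h
      have hneg := h₁.isPosMeasure.orderIntegral_neg hE hE' h₂.isPosMeasure (hι f)
      rw [neg_sub] at hneg
      rw [hneg, neg_smul_neg, ← neg_sub ν₁, neg_smul_neg] at h
      exact h

variable [Lattice F] [IsOrderedAddMonoid F]

theorem orderIntegral_linearMap_mono (hE : IsDedekindComplete E)
    (hE' : IsNormalVectorLattice E)
    (ι : F →ₗ[ℝ] X → ℝ) (hι : ∀ f, IsBoundedMeasurable (ι f)) (hpos : ∀ f, 0 ≤ f → 0 ≤ ι f)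
    {Φ : regularBorelMeasures X E →ₗ[ℝ] normToOrderBounded F E}
    (hΦ : ∀ μ f, (Φ μ : F →ₗ[ℝ] E) f = orderIntegral μ.1 (ι f)) : Monotone Φ := by
  intro μ μ' h f hf
  rw [← sub_nonneg]
  have h1 : (Φ (μ' - μ)).1 f = (Φ μ').1 f - (Φ μ).1 f := by
    rw [map_sub]
    rfl
  rw [← h1, hΦ]
  obtain ⟨ν₁, ν₂, h₁, h₂, hν⟩ := (mem_regularBorelMeasures_iff hE hE').1 (μ' - μ).2
  rw [hν]
  refine h₁.isPosMeasure.orderIntegral_nonneg hE hE' h₂.isPosMeasure ?_ (hι f) (hpos f hf)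
  rw [← sub_nonneg, ← hν]
  exact sub_nonneg.2 (show μ.1 ≤ μ'.1 from h)

end OrderIntegralOperator

/-! ### Bijectivity and order on `C_c(X)`, and the passage to `C₀(X)` -/

section Isomorphism

open MeasureTheory

variable {X E : Type*} [TopologicalSpace X] [T2Space X] [LocallyCompactSpace X]
  [MeasurableSpace X] [BorelSpace X] [AddCommGroup E] [Lattice E] [IsOrderedAddMonoid E]
  [Module ℝ E] [IsOrderedModule ℝ E]

theorem exists_isPosRegularBorelMeasure_of_mem_normToOrderBounded (hE : IsDedekindComplete E)
    (hE' : IsNormalVectorLattice E) {T : C_c(X, ℝ) →ₗ[ℝ] E}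
    (hT : T ∈ normToOrderBounded C_c(X, ℝ) E) (hpos : ∀ f, 0 ≤ f → 0 ≤ T f) :
    ∃ ν : {s : Set X // MeasurableSet s} → E, IsPosRegularBorelMeasure ν ∧
      ∀ f : C_c(X, ℝ), orderIntegral (ν - 0) f = T f := by
  obtain ⟨a, b, hab⟩ := exists_bounds_of_mem_normToOrderBounded hT 1
  exact exists_isPosRegularBorelMeasure_orderIntegral_eq hE hE' T hpos (b := a) fun f hf =>
    (hab f ((f.norm_le_iff zero_le_one).2 fun x => by
      rw [abs_of_nonneg (hf x).1]
      exact (hf x).2)).1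

variable {Φ : regularBorelMeasures X E →ₗ[ℝ] normToOrderBounded C_c(X, ℝ) E}

theorem orderIntegral_linearMap_injective (hE : IsDedekindComplete E)
    (hE' : IsNormalVectorLattice E)
    (hΦ : ∀ μ (f : C_c(X, ℝ)), (Φ μ : C_c(X, ℝ) →ₗ[ℝ] E) f = orderIntegral μ.1 f) :
    Function.Injective Φ := by
  rw [injective_iff_map_eq_zero]
  rintro ⟨μ, hμ⟩ h
  obtain ⟨ν₁, ν₂, h₁, h₂, rfl⟩ := (mem_regularBorelMeasures_iff hE hE').1 hμ
  have := h₁.eq_of_orderIntegral_eq_zero hE hE' h₂ fun f => by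
    rw [← hΦ ⟨ν₁ - ν₂, hμ⟩ f, h]
    rfl
  exact Subtype.ext (sub_eq_zero.2 this)

theorem orderIntegral_linearMap_surjective (hE : IsDedekindComplete E)
    (hE' : IsNormalVectorLattice E)
    (hΦ : ∀ μ (f : C_c(X, ℝ)), (Φ μ : C_c(X, ℝ) →ₗ[ℝ] E) f = orderIntegral μ.1 f) :
    Function.Surjective Φ := by
  rintro ⟨T, hT⟩
  obtain ⟨P, hP, Q, hQ, hP0, hQ0, rfl⟩ := exists_pos_sub_pos_of_mem_normToOrderBounded hE hT
  obtain ⟨ν₁, h₁, hν₁⟩ :=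
    exists_isPosRegularBorelMeasure_of_mem_normToOrderBounded hE hE' hP hP0
  obtain ⟨ν₂, h₂, hν₂⟩ :=
    exists_isPosRegularBorelMeasure_of_mem_normToOrderBounded hE hE' hQ hQ0
  refine ⟨⟨ν₁ - ν₂, (mem_regularBorelMeasures_iff hE hE').2 ⟨ν₁, ν₂, h₁, h₂, rfl⟩⟩,
    Subtype.ext (LinearMap.ext fun f => ?_)⟩
  rw [hΦ, h₁.isPosMeasure.orderIntegral_sub hE hE' h₂.isPosMeasure f.isBoundedMeasurable, hν₁, hν₂]
  rfl

/-- For the reflection of order, the positive operator `Φ (μ' - μ)` is represented by some positive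
`ν`, and injectivity forces `ν = μ' - μ`. -/
theorem orderIntegral_linearMap_le_iff (hE : IsDedekindComplete E)
    (hE' : IsNormalVectorLattice E)
    (hΦ : ∀ μ (f : C_c(X, ℝ)), (Φ μ : C_c(X, ℝ) →ₗ[ℝ] E) f = orderIntegral μ.1 f)
    (μ μ' : regularBorelMeasures X E) : Φ μ ≤ Φ μ' ↔ μ ≤ μ' := by
  constructor
  · intro h
    obtain ⟨ν, hν, hνΦ⟩ := exists_isPosRegularBorelMeasure_of_mem_normToOrderBounded hE hE'
      (T := (Φ (μ' - μ)).1) (Φ (μ' - μ)).2 fun f hf => by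
        rw [map_sub]
        exact sub_nonneg.2 (h f hf)
    have h0 := isPosRegularBorelMeasure_zero (X := X) hE hE'
    have hmem : ν - 0 ∈ regularBorelMeasures X E :=
      (mem_regularBorelMeasures_iff hE hE').2 ⟨ν, 0, hν, h0, rfl⟩
    have heq : (⟨ν - 0, hmem⟩ : regularBorelMeasures X E) = μ' - μ :=
      orderIntegral_linearMap_injective hE hE' hΦ
        (Subtype.ext (LinearMap.ext fun f => (hΦ _ f).trans (hνΦ f)))
    have heq' : ν = μ'.1 - μ.1 := by
      rw [← sub_zero ν]
      exact congrArg Subtype.val heq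
    change μ.1 ≤ μ'.1
    rw [← sub_nonneg, ← heq']
    exact hν.isPosMeasure.nonneg
  · intro h
    exact orderIntegral_linearMap_mono hE hE'
      { toFun := fun f : C_c(X, ℝ) => (f : X → ℝ), map_add' := fun _ _ => rfl,
        map_smul' := fun _ _ => rfl } (fun f => f.isBoundedMeasurable) (fun _ hf => hf) hΦ h

omit [LocallyCompactSpace X] [MeasurableSpace X] [BorelSpace X] in
/-- A norm to order bounded operator on `C₀(X, ℝ)` that vanishes on `C_c(X, ℝ)` is zero. -/
theorem eq_zero_of_forall_toZeroAtInftyReal (hE' : IsNormalVectorLattice E)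
    {T : C₀(X, ℝ) →ₗ[ℝ] E} (hT : T ∈ normToOrderBounded C₀(X, ℝ) E)
    (h : ∀ f, T (CompactlySupportedContinuousMap.toZeroAtInftyReal f) = 0) : T = 0 := by
  obtain ⟨a, b, hab⟩ := exists_bounds_of_mem_normToOrderBounded hT 1
  refine LinearMap.ext fun f => hE'.eq_of_forall fun φ hφ => ?_
  -- For `g` in `C_c(X)` within `ε` of `f`, the unit ball contains `ε⁻¹ • (f - g)`, and `T` vanishes
  -- at `g`; so `T f` lies between `ε • b` and `ε • a`. Letting `ε → 0` after applying `φ` gives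
  -- zero.
  have hbound : ∀ ε : ℝ, 0 < ε → φ (T f) ≤ ε * φ a ∧ ε * φ b ≤ φ (T f) := by
    intro ε hε
    obtain ⟨g, hg⟩ := f.exists_norm_sub_toZeroAtInftyReal_le hε
    obtain ⟨h1, h2⟩ := hab (ε⁻¹ • (f - CompactlySupportedContinuousMap.toZeroAtInftyReal g)) (by
      rw [norm_smul, norm_inv, Real.norm_of_nonneg hε.le, inv_mul_le_iff₀ hε, mul_one]
      exact hg)
    rw [map_smul, map_sub, h, sub_zero] at h1 h2
    have h1' := hφ.mono h1
    have h2' := hφ.mono h2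
    rw [map_smul, smul_eq_mul] at h1' h2'
    rw [inv_mul_le_iff₀ hε] at h1'
    rw [le_inv_mul_iff₀ hε] at h2'
    exact ⟨h1', h2'⟩
  have hlim : ∀ c : ℝ, Filter.Tendsto (fun ε : ℝ => ε * c) (nhdsWithin 0 (Set.Ioi 0)) (nhds 0) :=
    fun c => by
      have : Filter.Tendsto (fun ε : ℝ => ε * c) (nhds 0) (nhds (0 * c)) :=
        (continuous_id.mul continuous_const).tendsto 0
      rw [zero_mul] at this
      exact this.mono_left nhdsWithin_le_nhds
  rw [LinearMap.zero_apply, map_zero]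
  exact le_antisymm
    (ge_of_tendsto (hlim (φ a)) (eventually_nhdsWithin_of_forall fun ε hε => (hbound ε hε).1))
    (le_of_tendsto (hlim (φ b)) (eventually_nhdsWithin_of_forall fun ε hε => (hbound ε hε).2))

omit [T2Space X] [LocallyCompactSpace X] [MeasurableSpace X] [BorelSpace X] in
theorem comp_toZeroAtInftyReal_mem_normToOrderBounded {T : C₀(X, ℝ) →ₗ[ℝ] E}
    (hT : T ∈ normToOrderBounded C₀(X, ℝ) E) :
    T ∘ₗ CompactlySupportedContinuousMap.toZeroAtInftyReal ∈ normToOrderBounded C_c(X, ℝ) E :=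
  mem_normToOrderBounded_of_forall fun r _ =>
    let ⟨a, b, hab⟩ := exists_bounds_of_mem_normToOrderBounded hT r
    ⟨a, b, fun _ hf => hab _ hf⟩

end Isomorphism

/-! ### Compact `X`: comparison with regular operators -/

section RegularOperators

variable {X E F : Type*} [TopologicalSpace X] [AddCommGroup E] [Lattice E]
  [IsOrderedAddMonoid E] [Module ℝ E] [IsOrderedModule ℝ E] [NormedAddCommGroup F] [Module ℝ F]
  [Lattice F] [HasSolidNorm F] [IsOrderedAddMonoid F] [IsOrderedModule ℝ F]

/-- Norm to order bounded operators split into positive ones. Conversely, a function in the ball of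
radius `r` lies between the constants `-r` and `r`, which are available in `C(X)`, so a positive `P`
maps the ball into the interval from `-P r` to `P r`. -/
theorem mem_normToOrderBounded_iff_comp_mem_regularOperators (hE : IsDedekindComplete E)
    (e : C(X, ℝ) ≃ₗ[ℝ] F) (hpos : ∀ f, 0 ≤ f → 0 ≤ e f) (hnorm : ∀ f x, |f x| ≤ ‖e f‖)
    (T : F →ₗ[ℝ] E) : T ∈ normToOrderBounded F E ↔
      T ∘ₗ e.toLinearMap ∈ regularOperators C(X, ℝ) E := by
  constructor
  · intro hT
    obtain ⟨P, -, Q, -, hP, hQ, rfl⟩ := exists_pos_sub_pos_of_mem_normToOrderBounded hE hT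
    exact ⟨P ∘ₗ e.toLinearMap, Q ∘ₗ e.toLinearMap, fun f hf => hP _ (hpos f hf),
      fun f hf => hQ _ (hpos f hf), LinearMap.sub_comp _ _ _⟩
  · have key : ∀ P : C(X, ℝ) →ₗ[ℝ] E, (∀ f, 0 ≤ f → 0 ≤ P f) →
        P ∘ₗ e.symm.toLinearMap ∈ normToOrderBounded F E := fun P hP =>
      mem_normToOrderBounded_of_forall fun r _ =>
        ⟨P (ContinuousMap.const X r), -P (ContinuousMap.const X r), fun f hf => by
          have hfr : ∀ x, |e.symm f x| ≤ r := fun x => by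
            refine (hnorm _ x).trans ?_
            rwa [e.apply_symm_apply]
          constructor
          · rw [← sub_nonneg]
            change 0 ≤ P _ - P (e.symm f)
            rw [← map_sub]
            exact hP _ fun x => sub_nonneg.2 (abs_le.1 (hfr x)).2
          · rw [neg_le_iff_add_nonneg]
            change 0 ≤ P (e.symm f) + P _
            rw [← map_add]
            exact hP _ fun x => neg_le_iff_add_nonneg.1 (abs_le.1 (hfr x)).1⟩
    rintro ⟨P, Q, hP, hQ, h⟩
    have hT : T = P ∘ₗ e.symm.toLinearMap - Q ∘ₗ e.symm.toLinearMap := by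
      rw [← LinearMap.sub_comp, ← h]
      ext f
      simp
    rw [hT]
    exact sub_mem (key P hP) (key Q hQ)

end RegularOperators

/-! ### The main theorem -/

theorem mainTheorem1 {X : Type*} [TopologicalSpace X] [T2Space X] [LocallyCompactSpace X]
    [Nonempty X] [MeasurableSpace X] [BorelSpace X]
    {E : Type*} [AddCommGroup E] [Lattice E] [IsOrderedAddMonoid E] [Module ℝ E]
    [IsOrderedModule ℝ E] (hE : IsDedekindComplete E) (hE' : IsNormalVectorLattice E) :
    -- the order integral `I_μ(f)` of a bounded measurable function exists and is well defined
    (∀ μ ∈ regularBorelMeasures X E, ∀ f : X → ℝ, Measurable f → (∃ C, ∀ x, |f x| ≤ C) →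
      ∃! e, HasOrderIntegral μ f e) ∧
    -- `μ ↦ I_μ` is an isomorphism of vector lattices onto the operators on `C_c(X)`
    (∃ Φ : regularBorelMeasures X E →ₗ[ℝ] normToOrderBounded C_c(X, ℝ) E,
      (∀ (μ : regularBorelMeasures X E) (f : C_c(X, ℝ)),
        (Φ μ : C_c(X, ℝ) →ₗ[ℝ] E) f = orderIntegral μ.1 f) ∧
      IsVectorLatticeIso Φ) ∧
    -- `μ ↦ I_μ` is an isomorphism of vector lattices onto the operators on `C₀(X)`
    (∃ Φ : regularBorelMeasures X E →ₗ[ℝ] normToOrderBounded C₀(X, ℝ) E,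
      (∀ (μ : regularBorelMeasures X E) (f : C₀(X, ℝ)),
        (Φ μ : C₀(X, ℝ) →ₗ[ℝ] E) f = orderIntegral μ.1 f) ∧
      IsVectorLatticeIso Φ) ∧
    -- for compact `X`, both spaces of operators are the regular operators on `C(X)`
    (∀ _ : CompactSpace X,
      (∀ T : C_c(X, ℝ) →ₗ[ℝ] E, T ∈ normToOrderBounded C_c(X, ℝ) E ↔
        T ∘ₗ (continuousLinearEquivCc X).toLinearMap ∈ regularOperators C(X, ℝ) E) ∧
      (∀ T : C₀(X, ℝ) →ₗ[ℝ] E, T ∈ normToOrderBounded C₀(X, ℝ) E ↔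
        T ∘ₗ (continuousLinearEquivC₀ X).toLinearMap ∈ regularOperators C(X, ℝ) E)) := by
  let ιc : C_c(X, ℝ) →ₗ[ℝ] X → ℝ :=
    { toFun := fun f => f, map_add' := fun _ _ => rfl, map_smul' := fun _ _ => rfl }
  let ι₀ : C₀(X, ℝ) →ₗ[ℝ] X → ℝ :=
    { toFun := fun f => f, map_add' := fun _ _ => rfl, map_smul' := fun _ _ => rfl }
  obtain ⟨Φc, hΦc⟩ := exists_orderIntegral_linearMap hE hE' ιc
    (fun f => f.isBoundedMeasurable) fun f => f.abs_apply_le_norm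
  obtain ⟨Φ₀, hΦ₀⟩ := exists_orderIntegral_linearMap hE hE' ι₀
    (fun f => f.isBoundedMeasurable) fun f => f.abs_apply_le_norm
  have hinj := orderIntegral_linearMap_injective hE hE' hΦc
  have hsurj := orderIntegral_linearMap_surjective hE hE' hΦc
  have hle := orderIntegral_linearMap_le_iff hE hE' hΦc
  have hrestr : ∀ (μ : regularBorelMeasures X E) (f : C_c(X, ℝ)), (Φc μ).1 f =
      (Φ₀ μ).1 (CompactlySupportedContinuousMap.toZeroAtInftyReal f) := fun μ f =>
    (hΦc μ f).trans (hΦ₀ μ (CompactlySupportedContinuousMap.toZeroAtInftyReal f)).symm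
  refine ⟨fun μ hμ f hf hC => ?_, ⟨Φc, hΦc, ?_⟩, ⟨Φ₀, hΦ₀, ?_⟩, fun _ => ⟨?_, ?_⟩⟩
  · obtain ⟨ν₁, ν₂, h₁, h₂, rfl⟩ := (mem_regularBorelMeasures_iff hE hE').1 hμ
    obtain ⟨e, he⟩ := h₁.isPosMeasure.exists_hasOrderIntegral hE hE' h₂.isPosMeasure ⟨hf, hC⟩
    exact ⟨e, he, fun e' he' => he'.unique hE' ⟨hf, hC⟩ he⟩
  · exact isVectorLatticeIso_of_le_iff Φc ⟨hinj, hsurj⟩ hle (isVectorLattice_normToOrderBounded hE)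
  · refine isVectorLatticeIso_of_le_iff Φ₀ ⟨?_, fun T => ?_⟩ (fun μ μ' => ⟨fun h => ?_, fun h => ?_⟩)
      (isVectorLattice_normToOrderBounded hE)
    · intro μ μ' h
      refine hinj (Subtype.ext (LinearMap.ext fun f => ?_))
      rw [hrestr, hrestr, h]
    -- A measure representing the restriction of `T` to `C_c(X)` represents `T` itself, since the
    -- difference vanishes on `C_c(X)`.
    · obtain ⟨μ, hμ⟩ := hsurj ⟨_, comp_toZeroAtInftyReal_mem_normToOrderBounded T.2⟩
      refine ⟨μ, ?_⟩
      rw [← sub_eq_zero]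
      refine Subtype.ext (eq_zero_of_forall_toZeroAtInftyReal hE' (Φ₀ μ - T).2 fun f => ?_)
      change (Φ₀ μ).1 _ - T.1 _ = 0
      rw [← hrestr, hμ]
      exact sub_self _
    -- Order is reflected already by the restrictions to `C_c(X)`.
    · refine (hle μ μ').1 fun f hf => ?_
      rw [hrestr, hrestr]
      exact h _ hf
    · exact orderIntegral_linearMap_mono hE hE' ι₀ (fun f => f.isBoundedMeasurable)
        (fun _ hf => hf) hΦ₀ h
  · exact mem_normToOrderBounded_iff_comp_mem_regularOperators hE (continuousLinearEquivCc X)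
      (fun _ hf => hf) fun f => (continuousLinearEquivCc X f).abs_apply_le_norm
  · exact mem_normToOrderBounded_iff_comp_mem_regularOperators hE (continuousLinearEquivC₀ X)
      (fun _ hf => hf) fun f => (continuousLinearEquivC₀ X f).abs_apply_le_norm
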